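/- Setting. Points lie in $\{0,1\}^d$, $d\ge 1$, with Hamming distance $\mathrm{dist}$; $P\subseteq\{0,1\}^d$ is a data set of $n$ points, and $r,c,\lambda$ are real numbers with $\lambda\ge 0$. The bit-sampling LSH data structure is defined as follows. Put $p_1=1-\frac rd$, $p_2=1-\frac{cr}{d}$, $\rho=\frac{\log(1/p_1)}{\log(1/p_2)}$, $k=\lceil\log_{1/p_2}n\rceil$ and $L=\lceil\lambda n^{\rho}\rceil$. Sample a multiset $G$ of $L$ hash functions $g:\{0,1\}^d\to\{0,1\}^k$, $g(p)=(p_{i_1},\dots,p_{i_k})$, where all the coordinates $i_1,\dots,i_k$ of all the functions are independent and uniform in $\{1,\dots,d\}$. On a query $q$, $\mathrm{QueryLSH}(q)$ returns some (arbitrarily chosen) element of $S=\{p\in P:\mathrm{dist}(p,q)\le cr,\ g(p)=g(q)\text{ for some }g\in G\}$, or $\bot$ if $S=\emptyset$; the choice is an arbitrary fixed function of $G$ and $q$. The adversarial walk. Given $z\in P$, $r$, $c$, $\lambda$ and access to $\mathrm{QueryLSH}$ only (fresh randomness, independent of $G$), put $t=2e^2(\lambda+1)$ and sample $q$ uniformly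 among the points at distance $\lfloor r-t\rfloor$ from $z$. While $\mathrm{QueryLSH}(q)=z$: if $\mathrm{dist}(q,z)\ge r$, stop and return $\bot$; otherwise find a bit $j$ by the inner procedure (which may stop and return $\bot$) and flip bit $j$ of $q$. When the loop ends, return $q$. Inner procedure, simple version: set $q'=q$; while $\mathrm{QueryLSH}(q')=z$, choose $j$ uniformly in $\{i:q'_i=z_i\}$ and flip $q'_j$, and if then $\mathrm{dist}(q',z)>cr$, stop and return $\bot$. The result is the last $j$. Inner procedure, fast version: set $q^{left}=q$, and let $q^{right}$ be $q$ with a uniformly random set of $\lfloor cr\rfloor-\mathrm{dist}(q,z)$ bits flipped among those $i$ with $q_i=z_i$. If $\mathrm{QueryLSH}(q^{right})=z$, stop and return $\bot$. While $D=\mathrm{dist}(q^{left},q^{right})>1$, let $q^{mid}$ be $q^{left}$ with $\lfloor D/2\rfloor$ of the bits flipped in which $q^{left}$ and $q^{right}$ differ (any choice that is a function of $q^{left}$ and $q^{right}$); set $q^{left}=q^{mid}$ if $\mathrm{QueryLSH}(q^{mid})=z$, and $q^{right}=q^{mid}$ otherwise. The result is the bit $j$ in which $q^{left}$ and $q^{right}$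 differ. Theorem. There is an absolute constant $C>0$ such that the following holds. Let $n>e$, $\lambda\ge 0$, $$28\ln^3 n\le r\le \frac{d}{28\ln n},\qquad \lambda\le\frac1{8e^2}\min\Big\{\frac r{\ln n},\,n^{1/8}\Big\}-1,\qquad 1+\frac{80+16\ln(\lambda+1)}{\ln n}\le c\le\ln n,$$ and suppose that $z\in P$ is at distance at least $2cr$ from every other point of $P$. Then, for the simple version as well as for the fast version of the walk, with probability at least $\frac14-\frac1n$ over $G$ and the random choices of the walk, it returns a point $q$ with $\mathrm{dist}(q,z)\le r$ and $\mathrm{QueryLSH}(q)=\bot$ (a false negative). The simple version always makes at most $C\,cr\,\max\{\lambda,1\}$ queries to $\mathrm{QueryLSH}$, and the fast version always makes at most $C\log_2(cr)\max\{\lambda,1\}$; for $\lambda\ge1$ these are the bounds $O(cr\cdot\lambda)$ and $O(\log(cr)\cdot\lambda)$. -/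

import Mathlib

noncomputable section

namespace AdversarialLSH

/-- Points of the Hamming cube `{0,1}^d`; the metric is `hammingDist`. -/
abbrev Point (d : ℕ) := Fin d → Bool

/-- Coordinates on which two points agree. -/
def agree {d : ℕ} (q z : Point d) : Finset (Fin d) := Finset.univ.filter fun i => q i = z i

/-- Coordinates on which two points differ. -/
def differ {d : ℕ} (q z : Point d) : Finset (Fin d) := Finset.univ.filter fun i => q i ≠ z i

/-- The point obtained from `q` by flipping the bits in `S`. -/
def flipBits {d : ℕ} (q : Point d) (S : Finset (Fin d)) : Point d :=
  fun i => if i ∈ S then !(q i) else q i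

/-- All points at Hamming distance exactly `s` from `z`. -/
def sphere {d : ℕ} (z : Point d) (s : ℕ) : Finset (Point d) :=
  Finset.univ.filter fun q => hammingDist q z = s

/-! ### The bit-sampling LSH data structure -/

/-- `k = ⌈log_{1/p₂} n⌉` with `p₂ = 1 - cr/d`. -/
def hashLen (n d : ℕ) (r c : ℝ) : ℕ := ⌈Real.logb (1 / (1 - c * r / d)) n⌉₊

/-- `ρ = log (1/p₁) / log (1/p₂)` with `p₁ = 1 - r/d` and `p₂ = 1 - cr/d`. -/
def rho (d : ℕ) (r c : ℝ) : ℝ :=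
  Real.log (1 / (1 - r / d)) / Real.log (1 / (1 - c * r / d))

/-- `L = ⌈λ n^ρ⌉`. -/
def numHashes (n d : ℕ) (r c lam : ℝ) : ℕ := ⌈lam * (n : ℝ) ^ rho d r c⌉₊

/-- A family of `L` hash functions `g : {0,1}^d → {0,1}^k`. Each of them is a `k`-tuple of
elementary hash functions `p ↦ p i`, given by the tuple of the coordinates `i`. -/
abbrev HashFamily (d k L : ℕ) := Fin L → Fin k → Fin d

/-- The value `g(p) ∈ {0,1}^k` of the hash function given by the coordinate tuple `g`. -/
def hashValue {d k : ℕ} (g : Fin k → Fin d) (p : Point d) : Fin k → Bool := fun j => p (g j)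

/-- The set `S` of all data points at distance at most `R` from `q` which collide with `q` under
some hash function of the family. -/
def candidates {d k L : ℕ} (P : Finset (Point d)) (R : ℝ) (G : HashFamily d k L) (q : Point d) :
    Finset (Point d) :=
  P.filter fun p => (∃ l, hashValue (G l) p = hashValue (G l) q) ∧ (hammingDist p q : ℝ) ≤ R

/-- A rule selecting an element of each nonempty candidate set (it may also depend on the hash
functions and on the query). -/
abbrev TieBreak (d k L : ℕ) :=
  HashFamily d k L → Point d → (S : Finset (Point d)) → S.Nonempty → S

/-- `QueryLSH(q)`: some point of the candidate set, or `⊥` (here `none`) if that set is empty. -/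
def queryLSH {d k L : ℕ} (tie : TieBreak d k L) (P : Finset (Point d)) (R : ℝ)
    (G : HashFamily d k L) (q : Point d) : Option (Point d) :=
  if h : (candidates P R G q).Nonempty then some (tie G q _ h).1 else none

/-! ### Randomized algorithms with query access to an oracle -/

/-- Randomized computations which carry along the number of oracle queries made so far. -/
abbrev QueryM := StateT ℕ PMF

/-- Ask the oracle `Q` for its answer on `x`, at the cost of one query. -/
def ask {d : ℕ} (Q : Point d → Option (Point d)) (x : Point d) : QueryM (Option (Point d)) :=
  fun m => PMF.pure (Q x, m + 1)

/-- A uniformly random element of `s` (`none` if `s` is empty). -/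
def sample {α : Type} (s : Finset α) : QueryM (Option α) :=
  fun m => if h : s.Nonempty then (PMF.uniformOfFinset s h).map fun a => (some a, m)
    else PMF.pure (none, m)

/-- `t = 2e²(λ + 1)`. -/
def offset (lam : ℝ) : ℝ := 2 * Real.exp 1 ^ 2 * (lam + 1)

/-! The loops below take a bound on the number of passes as a first argument. It is always
initialised with `d + 1`. In the two walks each pass increases a Hamming distance from `z`,
and in the binary search each pass decreases a Hamming distance, so this bound is never reached. -/

/-- The inner loop of the simple walk: while the oracle returns `z` on the current point, flip a
uniformly random bit on which the current point agrees with `z`, and fail if this leads to a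
distance greater than `R` from `z`. Returns the last bit flipped. -/
def simpleInner {d : ℕ} (Q : Point d → Option (Point d)) (z : Point d) (R : ℝ) :
    ℕ → Option (Fin d) → Point d → QueryM (Option (Fin d))
  | 0, _, _ => pure none
  | fuel + 1, last, q => do
    let a ← ask Q q
    if a = some z then
      let j ← sample (agree q z)
      match j with
      | none => pure none
      | some j =>
        if R < (hammingDist (flipBits q {j}) z : ℝ) then pure none
        else simpleInner Q z R fuel (some j) (flipBits q {j})
    else pure last

/-- The inner loop of the fast walk: as long as `left` and `right` differ in more than one bit,
flip in `left` half of the bits (rounded down) in which they differ, where `pick left right` are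
the bits to be flipped, and replace `left` or `right` by the result, according to the answer of
the oracle. Returns the set of bits in which the final points differ. -/
def binarySearch {d : ℕ} (pick : Point d → Point d → Finset (Fin d))
    (Q : Point d → Option (Point d)) (z : Point d) :
    ℕ → Point d → Point d → QueryM (Option (Finset (Fin d)))
  | 0, _, _ => pure none
  | fuel + 1, left, right =>
    if 1 < hammingDist left right then do
      let a ← ask Q (flipBits left (pick left right))
      if a = some z then binarySearch pick Q z fuel (flipBits left (pick left right)) right
      else binarySearch pick Q z fuel left (flipBits left (pick left right))
    else pure (some (differ left right))

/-- The admissible choices of the bits flipped in the binary search. -/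
def IsHalving {d : ℕ} (pick : Point d → Point d → Finset (Fin d)) : Prop :=
  ∀ left right, pick left right ⊆ differ left right ∧
    (pick left right).card = hammingDist left right / 2

/-- The part of the fast walk which searches for a bit to be flipped in `q`: flip
`⌊R⌋ - dist(q, z)` random bits on which `q` agrees with `z`, fail if the oracle still returns `z`,
and otherwise run the binary search. The resulting set of bits is a singleton. -/
def fastInner {d : ℕ} (pick : Point d → Point d → Finset (Fin d))
    (Q : Point d → Option (Point d)) (z : Point d) (R : ℝ) (q : Point d) :
    QueryM (Option (Finset (Fin d))) := do
  let S ← sample ((agree q z).powersetCard (⌊R⌋₊ - hammingDist q z))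
  match S with
  | none => pure none
  | some S =>
    let a ← ask Q (flipBits q S)
    if a = some z then pure none
    else binarySearch pick Q z (d + 1) q (flipBits q S)

/-- The outer loop of both walks: while the oracle returns `z` on `q`, fail if `dist(q, z) ≥ r`,
and otherwise run `inner` on `q` and flip the bit which it has found. -/
def outerLoop {d : ℕ} (Q : Point d → Option (Point d)) (z : Point d) (r : ℝ)
    (inner : Point d → QueryM (Option (Finset (Fin d)))) :
    ℕ → Point d → QueryM (Option (Point d))
  | 0, _ => pure none
  | fuel + 1, q => do
    let a ← ask Q q
    if a = some z then
      if r ≤ (hammingDist q z : ℝ) then pure none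
      else
        let S ← inner q
        match S with
        | none => pure none
        | some S => outerLoop Q z r inner fuel (flipBits q S)
    else pure (some q)

/-- Both walks: start at a random point at distance `⌊r - t⌋` from `z` and run the outer loop. -/
def walk {d : ℕ} (Q : Point d → Option (Point d)) (z : Point d) (r lam : ℝ)
    (inner : Point d → QueryM (Option (Finset (Fin d)))) : QueryM (Option (Point d)) := do
  let q ← sample (sphere z ⌊r - offset lam⌋₊)
  match q with
  | none => pure none
  | some q => outerLoop Q z r inner (d + 1) q

/-- The simple adversarial walk from `z`, with oracle `Q`. -/
def simpleWalk {d : ℕ} (z : Point d) (r c lam : ℝ) (Q : Point d → Option (Point d)) :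
    QueryM (Option (Point d)) :=
  walk Q z r lam fun q => do
    let j ← simpleInner Q z (c * r) (d + 1) none q
    pure (j.map fun j => {j})

/-- The fast adversarial walk from `z`, with oracle `Q`. -/
def fastWalk {d : ℕ} (pick : Point d → Point d → Finset (Fin d)) (z : Point d) (r c lam : ℝ)
    (Q : Point d → Option (Point d)) : QueryM (Option (Point d)) :=
  walk Q z r lam (fastInner pick Q z (c * r))

/-- One run of an adversary against the data structure with uniformly random hash functions: the
joint distribution of the hash functions, the output of the adversary and the number of queries
which it makes. -/
def attack {d k L : ℕ} [NeZero d] (tie : TieBreak d k L) (P : Finset (Point d)) (R : ℝ)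
    (adversary : (Point d → Option (Point d)) → QueryM (Option (Point d))) :
    PMF (HashFamily d k L × Option (Point d) × ℕ) :=
  (PMF.uniformOfFintype (HashFamily d k L)).bind fun G =>
    ((adversary (queryLSH tie P R G)).run 0).map fun out => (G, out)

/-- The event that the adversary outputs a point `q` at distance at most `r` from `z` on which the
data structure returns no point. -/
def successEvent {d k L : ℕ} (tie : TieBreak d k L) (P : Finset (Point d)) (R r : ℝ)
    (z : Point d) : Set (HashFamily d k L × Option (Point d) × ℕ) :=
  {w | ∃ q, w.2.1 = some q ∧ (hammingDist q z : ℝ) ≤ r ∧ queryLSH tie P R w.1 q = none}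

end AdversarialLSH

end

open AdversarialLSH

noncomputable section

/-! Call a hash function a survivor at `q` if `q` collides with `z` under it, that is, if it reads
only coordinates on which `q` and `z` agree. Every other data point is at distance at least `2cr`
from `z`, so at distance less than `cr` from `z` the oracle answers `z` if there is a survivor and
`⊥` otherwise (`queryLSH_eq_some_iff`, `queryLSH_eq_none`). Flipping bits away from `z` can only
shrink the set of survivors.

If a single flip removes the last survivors at some point reached from `q`, then the flipped bit is
read by a survivor at `q` (`informative_of_survivors`), and flipping it in `q` itself already loses
a survivor. Hence, if the walk starts at distance `s` with `N` survivors and `s + N ≤ r`, then `N`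
successful inner searches are enough to reach a false negative at distance at most `r`
(`failProb_outerLoop`).

An inner search succeeds once its random flips leave no survivor at distance `⌊cr⌋`. A survivor that
reads at least `3k/4` distinct coordinates is missed by one random flip with probability at most `β
= exp(-3k/(4d))`, so the expected number left after `b` flips is at most `N β ^ b`. This first
moment bounds the failure of both versions (`failProb_simpleInner`, `failProb_fastInner`).

Three events, each of probability at most `1/4`, account for all failures, for every fixed starting
point on the sphere: too many survivors at the start (Markov's inequality; the mean is at most `e (λ
+ 1)`); a survivor reading fewer than `3k/4` distinct coordinates (a birthday estimate); and a
failed inner search (`missRate_bound`). The query bounds hold on the whole support: each outer pass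
moves away from `z` by one bit, and only `O(λ + 1)` passes fit between the start and distance `r`.
-/

namespace AdversarialLSH

open Finset
open scoped ENNReal NNReal

/-! ### Bit flips and Hamming distances in the cube -/

section Cube

variable {d : ℕ}

@[simp] lemma mem_agree {q z : Point d} {i : Fin d} : i ∈ agree q z ↔ q i = z i := by
  simp [agree]

@[simp] lemma mem_differ {q z : Point d} {i : Fin d} : i ∈ differ q z ↔ q i ≠ z i := by
  simp [differ]

lemma card_differ (q z : Point d) : (differ q z).card = hammingDist q z := rfl

lemma agree_eq_compl (q z : Point d) : agree q z = (differ q z)ᶜ := by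
  ext i; simp

lemma card_agree (q z : Point d) : (agree q z).card = d - hammingDist q z := by
  rw [agree_eq_compl, card_compl, card_differ, Fintype.card_fin]

lemma hammingDist_le_dim (q z : Point d) : hammingDist q z ≤ d := by
  simpa using hammingDist_le_card_fintype (x := q) (y := z)

lemma differ_flipBits {q z : Point d} {S : Finset (Fin d)} (hS : S ⊆ agree q z) :
    differ (flipBits q S) z = differ q z ∪ S := by
  ext i
  by_cases hi : i ∈ S
  · have := mem_agree.1 (hS hi)
    simp [flipBits, hi, this]
  · simp [flipBits, hi]

lemma differ_flipBits_self (q : Point d) (S : Finset (Fin d)) : differ q (flipBits q S) = S := by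
  ext i
  by_cases hi : i ∈ S <;> simp [flipBits, hi]

lemma hammingDist_flipBits {q z : Point d} {S : Finset (Fin d)} (hS : S ⊆ agree q z) :
    hammingDist (flipBits q S) z = hammingDist q z + S.card := by
  rw [← card_differ, differ_flipBits hS, card_union_of_disjoint, card_differ]
  rw [Finset.disjoint_left]
  intro i hi hiS
  exact mem_differ.1 hi (mem_agree.1 (hS hiS))

lemma hammingDist_flipBits_singleton {q z : Point d} {j : Fin d} (hj : j ∈ agree q z) :
    hammingDist (flipBits q {j}) z = hammingDist q z + 1 := by
  simpa using hammingDist_flipBits (singleton_subset_iff.2 hj)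

lemma differ_eq_sdiff {p q z : Point d} (h : differ p z ⊆ differ q z) :
    differ p q = differ q z \ differ p z := by
  ext i
  have hi : p i ≠ z i → q i ≠ z i := fun h' => mem_differ.1 (h (mem_differ.2 h'))
  simp only [mem_differ, mem_sdiff, not_not]
  revert hi
  cases p i <;> cases q i <;> cases z i <;> simp

lemma agree_antitone {p q z : Point d} (h : differ p z ⊆ differ q z) : agree q z ⊆ agree p z := by
  rw [agree_eq_compl, agree_eq_compl]
  exact compl_subset_compl.2 h

lemma sphere_nonempty (z : Point d) {s : ℕ} (hs : s ≤ d) : (sphere z s).Nonempty := by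
  obtain ⟨S, -, hS⟩ := exists_subset_card_eq (s := (univ : Finset (Fin d))) (n := s) (by simpa)
  refine ⟨flipBits z S, ?_⟩
  simp only [sphere, mem_filter, mem_univ, true_and]
  rw [hammingDist_comm, ← card_differ, differ_flipBits_self, hS]

end Cube

/-! ### Surviving hash functions and the answers of the oracle -/

section Survivors

variable {d k L : ℕ}

/-- The coordinates read by a hash function. -/
def coords (g : Fin k → Fin d) : Finset (Fin d) := univ.image g

/-- The hash functions of the family under which `q` collides with `z`. -/
def survivors (G : HashFamily d k L) (z q : Point d) : Finset (Fin L) :=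
  univ.filter fun l => hashValue (G l) z = hashValue (G l) q

lemma mem_survivors {G : HashFamily d k L} {z q : Point d} {l : Fin L} :
    l ∈ survivors G z q ↔ coords (G l) ⊆ agree q z := by
  simp only [survivors, mem_filter, mem_univ, true_and, funext_iff, hashValue, coords,
    subset_iff, mem_image, mem_agree, forall_exists_index, forall_apply_eq_imp_iff]
  exact forall_congr' fun j => eq_comm

lemma survivors_antitone {G : HashFamily d k L} {z p q : Point d}
    (h : differ p z ⊆ differ q z) : survivors G z q ⊆ survivors G z p := fun _ hl =>
  mem_survivors.2 ((mem_survivors.1 hl).trans (agree_antitone h))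

lemma mem_survivors_flipBits {G : HashFamily d k L} {z q : Point d} {S : Finset (Fin d)}
    (hS : S ⊆ agree q z) {l : Fin L} :
    l ∈ survivors G z (flipBits q S) ↔ l ∈ survivors G z q ∧ Disjoint (coords (G l)) S := by
  rw [mem_survivors, mem_survivors, agree_eq_compl, agree_eq_compl, differ_flipBits hS,
    compl_union, subset_inter_iff, subset_compl_iff_disjoint_right (s := coords (G l)) (t := S)]

/-- The bit `j` is still unflipped in `q` and is read by a hash function under which `q` collides
with `z`. -/
def Informative (G : HashFamily d k L) (z q : Point d) (j : Fin d) : Prop :=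
  j ∈ agree q z ∧ ∃ l ∈ survivors G z q, j ∈ coords (G l)

lemma Informative.card_survivors_lt {G : HashFamily d k L} {z q : Point d} {j : Fin d}
    (h : Informative G z q j) :
    (survivors G z (flipBits q {j})).card < (survivors G z q).card := by
  obtain ⟨hj, l, hl, hjl⟩ := h
  have hS := singleton_subset_iff.2 hj
  refine card_lt_card ⟨fun l hl => ((mem_survivors_flipBits hS).1 hl).1, fun h => ?_⟩
  have := ((mem_survivors_flipBits hS).1 (h hl)).2
  exact disjoint_left.1 this hjl (mem_singleton_self j)

/-- A survivor at `p` that is lost by flipping `j` must read `j`, and by monotonicity it is also a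
survivor at the earlier point `q`. This transfers a bit found far from `z` back to the point at
which the inner search began. -/
lemma informative_of_survivors {G : HashFamily d k L} {z q p : Point d} {j : Fin d}
    (hqp : differ q z ⊆ differ p z) (hj : j ∈ agree p z) (hp : (survivors G z p).Nonempty)
    (h : survivors G z (flipBits p {j}) = ∅) : Informative G z q j := by
  obtain ⟨l, hl⟩ := hp
  refine ⟨agree_antitone hqp hj, l, survivors_antitone hqp hl, ?_⟩
  by_contra hjl
  have : l ∈ survivors G z (flipBits p {j}) :=
    (mem_survivors_flipBits (singleton_subset_iff.2 hj)).2 ⟨hl, by simpa using hjl⟩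
  simp [h] at this

variable {tie : TieBreak d k L} {P : Finset (Point d)} {R : ℝ} {G : HashFamily d k L}
  {z q : Point d}

lemma mem_candidates_self (hz : z ∈ P) (hq : (hammingDist q z : ℝ) ≤ R) :
    z ∈ candidates P R G q ↔ (survivors G z q).Nonempty := by
  simp [candidates, hz, hammingDist_comm z q, hq, survivors, Finset.Nonempty]

/-- By the triangle inequality a candidate `p ≠ z` would be at distance less than `2R` from `z`.
This needs the strict bound on the distance from `q` to `z`; at distance exactly `R` another point
might be returned. -/
lemma candidates_subset (hP : ∀ p ∈ P, p ≠ z → 2 * R ≤ (hammingDist p z : ℝ))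
    (hq : (hammingDist q z : ℝ) < R) : candidates P R G q ⊆ {z} := by
  intro p hp
  simp only [candidates, mem_filter] at hp
  rw [mem_singleton]
  by_contra hne
  have h1 := hP p hp.1 hne
  have h2 : (hammingDist p z : ℝ) ≤ hammingDist p q + hammingDist q z := by
    exact_mod_cast hammingDist_triangle p q z
  linarith [hp.2.2]

lemma queryLSH_mem {p : Point d} (h : queryLSH tie P R G q = some p) :
    p ∈ candidates P R G q := by
  unfold queryLSH at h
  split_ifs at h with hne
  rw [← Option.some.inj h]
  exact (tie G q _ hne).2

lemma queryLSH_eq_none_iff : queryLSH tie P R G q = none ↔ candidates P R G q = ∅ := by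
  unfold queryLSH
  split_ifs with h
  · simp [h.ne_empty]
  · simpa using h

lemma survivors_nonempty_of_queryLSH (h : queryLSH tie P R G q = some z) :
    (survivors G z q).Nonempty := by
  have := queryLSH_mem h
  simp only [candidates, mem_filter] at this
  obtain ⟨l, hl⟩ := this.2.1
  exact ⟨l, by simp [survivors, hl]⟩

lemma queryLSH_eq_some_iff (hz : z ∈ P) (hP : ∀ p ∈ P, p ≠ z → 2 * R ≤ (hammingDist p z : ℝ))
    (hq : (hammingDist q z : ℝ) < R) :
    queryLSH tie P R G q = some z ↔ (survivors G z q).Nonempty := by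
  refine ⟨survivors_nonempty_of_queryLSH, fun h => ?_⟩
  have hz' := (mem_candidates_self (G := G) hz hq.le).2 h
  rcases hQ : queryLSH tie P R G q with _ | p
  · rw [queryLSH_eq_none_iff] at hQ
    simp [hQ] at hz'
  · rw [mem_singleton.1 (candidates_subset hP hq (queryLSH_mem hQ))]

lemma queryLSH_eq_none (hP : ∀ p ∈ P, p ≠ z → 2 * R ≤ (hammingDist p z : ℝ))
    (hq : (hammingDist q z : ℝ) < R) (h : queryLSH tie P R G q ≠ some z) :
    queryLSH tie P R G q = none := by
  rcases hQ : queryLSH tie P R G q with _ | p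
  · rfl
  · exact absurd (by rw [hQ, mem_singleton.1 (candidates_subset hP hq (queryLSH_mem hQ))]) h

end Survivors

/-! ### Failure probabilities and query counts of randomized computations -/

section Calculus

variable {α β : Type}

/-- The probability that the result of `x`, started with `m` queries, is not `good`. -/
def failProb (x : QueryM α) (good : α → Prop) (m : ℕ) : ℝ≥0∞ :=
  (x m).toOuterMeasure {p | ¬ good p.1}

lemma toOuterMeasure_univ {γ : Type*} (p : PMF γ) : p.toOuterMeasure Set.univ = 1 :=
  (p.toOuterMeasure_apply_eq_one_iff _).2 (Set.subset_univ _)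

lemma toOuterMeasure_le_one {γ : Type*} (p : PMF γ) (s : Set γ) : p.toOuterMeasure s ≤ 1 :=
  (MeasureTheory.measure_mono (Set.subset_univ s)).trans (toOuterMeasure_univ p).le

lemma failProb_le_one (x : QueryM α) (good : α → Prop) (m : ℕ) : failProb x good m ≤ 1 :=
  toOuterMeasure_le_one _ _

lemma QueryM.bind_apply (x : QueryM α) (f : α → QueryM β) (m : ℕ) :
    (x >>= f) m = (x m).bind fun p => f p.1 p.2 := rfl

lemma QueryM.pure_apply (a : α) (m : ℕ) : (pure a : QueryM α) m = PMF.pure (a, m) := rfl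

lemma failProb_pure {good : α → Prop} {a : α} (h : good a) (m : ℕ) :
    failProb (pure a) good m = 0 := by
  rw [failProb, QueryM.pure_apply, PMF.toOuterMeasure_pure_apply]
  simp [h]

lemma failProb_ask_bind {d : ℕ} (Q : Point d → Option (Point d)) (x : Point d)
    (f : Option (Point d) → QueryM β) (good : β → Prop) (m : ℕ) :
    failProb (ask Q x >>= f) good m = failProb (f (Q x)) good (m + 1) := by
  rw [failProb, QueryM.bind_apply, ask, PMF.pure_bind]
  rfl

lemma failProb_sample_bind {s : Finset α} (hs : s.Nonempty) (f : Option α → QueryM β)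
    (good : β → Prop) (m : ℕ) :
    failProb (sample s >>= f) good m = (∑ a ∈ s, failProb (f (some a)) good m) / s.card := by
  rw [failProb, QueryM.bind_apply, sample, dif_pos hs, PMF.bind_map,
    PMF.toOuterMeasure_bind_apply, tsum_eq_sum (s := s)]
  · rw [ENNReal.div_eq_inv_mul, mul_sum]
    refine sum_congr rfl fun a ha => ?_
    rw [PMF.uniformOfFinset_apply_of_mem hs ha]
    rfl
  · intro a ha
    rw [PMF.uniformOfFinset_apply_of_notMem hs ha, zero_mul]

/-- Union bound for sequential composition: either the first stage misses `ok`, or the second stage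
fails from an `ok` result, whatever the query counter shows. -/
lemma failProb_bind_le {x : QueryM α} {f : α → QueryM β} {good : β → Prop} {ok : α → Prop}
    {m : ℕ} {ε : ℝ≥0∞} (h : ∀ a, ok a → ∀ m, failProb (f a) good m ≤ ε) :
    failProb (x >>= f) good m ≤ failProb x ok m + ε := by
  classical
  rw [failProb, QueryM.bind_apply, PMF.toOuterMeasure_bind_apply, failProb,
    PMF.toOuterMeasure_apply]
  calc ∑' p, x m p * (f p.1 p.2).toOuterMeasure {p | ¬ good p.1}
      ≤ ∑' p, ({p | ¬ ok p.1}.indicator (x m) p + x m p * ε) := by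
        refine ENNReal.tsum_le_tsum fun p => ?_
        by_cases hp : ok p.1
        · exact (mul_le_mul_right (h _ hp p.2) _).trans le_add_self
        · rw [Set.indicator_of_mem (by exact hp)]
          refine le_add_right ?_
          exact mul_le_of_le_one_right' (failProb_le_one (f p.1) good p.2)
    _ = _ := by
        rw [ENNReal.tsum_add, ENNReal.tsum_mul_right, PMF.tsum_coe, one_mul]

/-- The computation `x` always makes at most `b` queries, and its result satisfies `post`. -/
def QueriesLE (x : QueryM α) (b : ℕ) (post : α → Prop) : Prop :=
  ∀ m, ∀ p ∈ (x m).support, p.2 ≤ m + b ∧ post p.1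

lemma queriesLE_pure {a : α} {post : α → Prop} (h : post a) (b : ℕ) :
    QueriesLE (pure a) b post := by
  intro m p hp
  rw [QueryM.pure_apply, PMF.mem_support_pure_iff] at hp
  subst hp
  exact ⟨Nat.le_add_right _ _, h⟩

lemma QueriesLE.bind {x : QueryM α} {f : α → QueryM β} {b b' : ℕ} {mid : α → Prop}
    {post : β → Prop} (hx : QueriesLE x b mid) (hf : ∀ a, mid a → QueriesLE (f a) b' post) :
    QueriesLE (x >>= f) (b + b') post := by
  intro m p hp
  rw [QueryM.bind_apply, PMF.mem_support_bind_iff] at hp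
  obtain ⟨a, ha, hp⟩ := hp
  obtain ⟨h1, h2⟩ := hx m a ha
  obtain ⟨h3, h4⟩ := hf a.1 h2 _ p hp
  exact ⟨by omega, h4⟩

lemma queriesLE_ask {d : ℕ} (Q : Point d → Option (Point d)) (x : Point d) :
    QueriesLE (ask Q x) 1 (· = Q x) := by
  intro m p hp
  rw [ask, PMF.mem_support_pure_iff] at hp
  subst hp
  exact ⟨le_rfl, rfl⟩

lemma queriesLE_sample (s : Finset α) : QueriesLE (sample s) 0 (∀ a ∈ ·, a ∈ s) := by
  intro m p hp
  unfold sample at hp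
  split_ifs at hp with hs
  · rw [PMF.mem_support_map_iff] at hp
    obtain ⟨a, ha, rfl⟩ := hp
    rw [PMF.mem_support_uniformOfFinset_iff] at ha
    simpa using ha
  · rw [PMF.mem_support_pure_iff] at hp
    subst hp
    simp

lemma QueriesLE.mono {x : QueryM α} {b b' : ℕ} {post post' : α → Prop}
    (hx : QueriesLE x b post) (hb : b ≤ b') (h : ∀ a, post a → post' a) :
    QueriesLE x b' post' := fun m p hp =>
  ⟨(hx m p hp).1.trans (by omega), h _ (hx m p hp).2⟩

end Calculus

/-! ### Counting random flips that miss a hash function -/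

section Counting

/-- Restricting the flips to the `N` bits still agreeing with `z`, among which are all `m`
coordinates of a survivor, only lowers the proportion of misses: `(N - m)/N ≤ (d - m)/d`. -/
lemma sub_le_mul_of_le {d N m : ℕ} {β : ℝ≥0} (hN : N ≤ d) (hm : m ≤ N)
    (h : ((d - m : ℕ) : ℝ) ≤ β * d) : ((N - m : ℕ) : ℝ) ≤ β * N := by
  rw [Nat.cast_sub (hm.trans hN)] at h
  rw [Nat.cast_sub hm]
  have hN' : (N : ℝ) ≤ d := by exact_mod_cast hN
  have hm' : (m : ℝ) ≤ N := by exact_mod_cast hm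
  have hm0 : (0 : ℝ) ≤ m := m.cast_nonneg
  rcases Nat.eq_zero_or_pos d with rfl | hd
  · have : (N : ℝ) = 0 := le_antisymm (by simpa using hN') N.cast_nonneg
    rw [this]; linarith
  · have hd' : (0 : ℝ) < d := by exact_mod_cast hd
    have h1 : (N : ℝ) * (d - m) ≤ N * (β * d) := mul_le_mul_of_nonneg_left h N.cast_nonneg
    have h2 : ((N : ℝ) - m) * d ≤ (β * N) * d := by nlinarith
    exact le_of_mul_le_mul_right h2 hd'

/-- Sampling without replacement is dominated by sampling with replacement: each factor `(M - i)/(N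
- i)` of the ratio of binomials is at most `β`. -/
lemma choose_le_pow_mul_choose {M N : ℕ} {β : ℝ} (hβ0 : 0 ≤ β) (hβ : β ≤ 1)
    (h : (M : ℝ) ≤ β * N) (a : ℕ) : (M.choose a : ℝ) ≤ β ^ a * N.choose a := by
  induction a with
  | zero => simp
  | succ a ih =>
    rcases Nat.lt_or_ge M (a + 1) with hM | hM
    · rw [Nat.choose_eq_zero_of_lt hM, Nat.cast_zero]
      positivity
    have hMN : (M : ℝ) ≤ N := h.trans (mul_le_of_le_one_left N.cast_nonneg hβ)
    have hMN' : M ≤ N := by exact_mod_cast hMN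
    have e1 : ((M.choose (a + 1) : ℕ) : ℝ) * (a + 1) = M.choose a * (M - a) := by
      have := Nat.choose_succ_right_eq M a
      rw [← Nat.cast_sub (by omega)]
      exact_mod_cast this
    have e2 : ((N.choose (a + 1) : ℕ) : ℝ) * (a + 1) = N.choose a * (N - a) := by
      have := Nat.choose_succ_right_eq N a
      rw [← Nat.cast_sub (by omega)]
      exact_mod_cast this
    have ha : (0 : ℝ) < a + 1 := by positivity
    refine le_of_mul_le_mul_right ?_ ha
    rw [e1, mul_assoc, e2]
    have h0 : (0 : ℝ) ≤ M - a := by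
      rw [sub_nonneg]; exact_mod_cast (by omega : a ≤ M)
    have h1 : (M : ℝ) - a ≤ β * (N - a) := by
      have : β * a ≤ a := mul_le_of_le_one_left a.cast_nonneg hβ
      linarith
    calc (M.choose a : ℝ) * (M - a) ≤ (β ^ a * N.choose a) * (β * (N - a)) :=
          mul_le_mul ih h1 h0 (by positivity)
      _ = _ := by ring

variable {d k L : ℕ} {G : HashFamily d k L} {z q : Point d}

/-- Double counting of pairs of a flip set and a survivor that it misses; this is linearity of
expectation for the number of survivors after a random flip. -/
lemma sum_card_survivors_flipBits {ι : Type*} (s : Finset ι) (f : ι → Finset (Fin d))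
    (hs : ∀ i ∈ s, f i ⊆ agree q z) :
    ∑ i ∈ s, (survivors G z (flipBits q (f i))).card =
      ∑ l ∈ survivors G z q, (s.filter fun i => Disjoint (coords (G l)) (f i)).card := by
  refine Eq.trans ?_ (sum_card_bipartiteAbove_eq_sum_card_bipartiteBelow
    (fun i l => Disjoint (coords (G l)) (f i)))
  refine sum_congr rfl fun i hi => congrArg card ?_
  ext l
  rw [mem_survivors_flipBits (hs i hi), mem_bipartiteAbove]

lemma natCast_div_le_coe {x N : ℕ} {b : ℝ≥0} (h : (x : ℝ) ≤ b * N) :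
    (x : ℝ≥0∞) / N ≤ b := by
  refine ENNReal.div_le_of_le_mul ?_
  have : (x : ℝ≥0) ≤ b * N := by exact_mod_cast h
  exact_mod_cast this

end Counting

/-! ### The inner searches find an informative bit -/

section Inner

variable {d k L : ℕ} {tie : TieBreak d k L} {P : Finset (Point d)} {R : ℝ} {G : HashFamily d k L}
  {z q₀ : Point d} {β : ℝ≥0}

/-- The bound is the expected number of survivors at distance `⌊R⌋`. In the induction, one random
flip multiplies the expected number of survivors by at most `β` and uses up one unit of the
exponent. The condition on `last` records that the most recent flip is informative at `q₀` as soon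
as no survivor remains. -/
lemma failProb_simpleInner (hz : z ∈ P) (hP : ∀ p ∈ P, p ≠ z → 2 * R ≤ (hammingDist p z : ℝ))
    (hR : 0 ≤ R) (hRd : R ≤ d)
    (hβ : ∀ l ∈ survivors G z q₀, ((d - (coords (G l)).card : ℕ) : ℝ) ≤ β * d) :
    ∀ (fuel : ℕ) (last : Option (Fin d)) (q : Point d), differ q₀ z ⊆ differ q z →
      d < fuel + hammingDist q z →
      (survivors G z q = ∅ → ∃ j, last = some j ∧ Informative G z q₀ j) → ∀ m,
      failProb (simpleInner (queryLSH tie P R G) z R fuel last q)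
        (fun o => ∃ j, o = some j ∧ Informative G z q₀ j) m ≤
        (survivors G z q).card * (β : ℝ≥0∞) ^ (⌊R⌋₊ - hammingDist q z) := by
  intro fuel
  induction fuel with
  | zero =>
    intro last q _ hfuel
    have := hammingDist_le_dim q z
    omega
  | succ fuel ih =>
    intro last q hsub hfuel hlast m
    rcases (survivors G z q).eq_empty_or_nonempty with hs | hs
    · have hQ : queryLSH tie P R G q ≠ some z := fun h => by
        have := survivors_nonempty_of_queryLSH h
        simp [hs] at this
      rw [simpleInner, failProb_ask_bind, if_neg hQ, failProb_pure
        (good := fun o => ∃ j, o = some j ∧ Informative G z q₀ j) (hlast hs)]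
      exact zero_le
    rcases Nat.lt_or_ge (hammingDist q z) ⌊R⌋₊ with hd | hd
    · have hdR : ((hammingDist q z : ℕ) : ℝ) + 1 ≤ R := by
        have := (Nat.le_floor_iff hR).1 (Nat.succ_le_of_lt hd)
        exact_mod_cast this
      have hQ : queryLSH tie P R G q = some z :=
        (queryLSH_eq_some_iff hz hP (by linarith)).2 hs
      have hdd : hammingDist q z < d := by
        have : ((hammingDist q z : ℕ) : ℝ) < d := by linarith
        exact_mod_cast this
      have hcard : 0 < (agree q z).card := by rw [card_agree]; omega
      rw [simpleInner, failProb_ask_bind, if_pos hQ, failProb_sample_bind (card_pos.1 hcard)]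
      obtain ⟨e, he⟩ : ∃ e, ⌊R⌋₊ - hammingDist q z = e + 1 :=
        ⟨⌊R⌋₊ - hammingDist q z - 1, by omega⟩
      have hstep : ∀ j ∈ agree q z, failProb
          (if R < (hammingDist (flipBits q {j}) z : ℝ) then pure none
            else simpleInner (queryLSH tie P R G) z R fuel (some j) (flipBits q {j}))
          (fun o => ∃ j, o = some j ∧ Informative G z q₀ j) (m + 1) ≤
          (survivors G z (flipBits q {j})).card * (β : ℝ≥0∞) ^ e := by
        intro j hj
        have hd1 := hammingDist_flipBits_singleton hj
        rw [if_neg (by rw [hd1]; push_cast; linarith)]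
        have := ih (some j) (flipBits q {j})
          (hsub.trans (by rw [differ_flipBits (singleton_subset_iff.2 hj)]; exact subset_union_left))
          (by rw [hd1]; omega)
          (fun h => ⟨j, rfl, informative_of_survivors hsub hj hs h⟩) (m + 1)
        rwa [hd1, show ⌊R⌋₊ - (hammingDist q z + 1) = e by omega] at this
      refine (ENNReal.div_le_div_right (sum_le_sum hstep) _).trans ?_
      rw [← sum_mul, he, pow_succ', ← mul_assoc, ← Nat.cast_sum, mul_comm, mul_div_assoc,
        mul_comm]
      refine mul_le_mul_left ?_ _
      have : ((survivors G z q).card : ℝ≥0∞) * β = (((survivors G z q).card * β : ℝ≥0) : ℝ≥0∞) := by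
        push_cast; rfl
      rw [this]
      refine natCast_div_le_coe ?_
      rw [sum_card_survivors_flipBits _ _ fun j hj => singleton_subset_iff.2 hj]
      push_cast
      rw [mul_assoc, ← nsmul_eq_mul]
      refine sum_le_card_nsmul _ _ _ fun l hl => ?_
      have hI := mem_survivors.1 hl
      have : (agree q z).filter (fun j => Disjoint (coords (G l)) {j}) =
          agree q z \ coords (G l) := by
        ext j; simp
      rw [this, card_sdiff_of_subset hI]
      exact sub_le_mul_of_le (by rw [card_agree]; omega) (card_le_card hI)
        (hβ l (survivors_antitone hsub hl))
    -- No flips are left in the exponent, and a remaining survivor makes the claimed bound at least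
    -- `1`.
    · refine (failProb_le_one _ _ _).trans ?_
      rw [Nat.sub_eq_zero_of_le hd, pow_zero, mul_one]
      exact_mod_cast card_pos.2 hs

variable {pick : Point d → Point d → Finset (Fin d)}

lemma IsHalving.midpoint (hpick : IsHalving pick) {left right : Point d}
    (hlr : differ left z ⊆ differ right z) :
    differ left z ⊆ differ (flipBits left (pick left right)) z ∧
      differ (flipBits left (pick left right)) z ⊆ differ right z ∧
      hammingDist left (flipBits left (pick left right)) = hammingDist left right / 2 ∧
      hammingDist (flipBits left (pick left right)) right =
        hammingDist left right - hammingDist left right / 2 := by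
  have hdiff := differ_eq_sdiff hlr
  obtain ⟨hp, hpc⟩ := hpick left right
  have hag : pick left right ⊆ agree left z := by
    refine hp.trans ?_
    rw [hdiff, agree_eq_compl, compl_eq_univ_sdiff]
    exact sdiff_subset_sdiff (subset_univ _) subset_rfl
  have hmid := differ_flipBits hag
  have hmr : differ (flipBits left (pick left right)) z ⊆ differ right z := by
    rw [hmid]
    exact union_subset hlr (hp.trans (by rw [hdiff]; exact sdiff_subset))
  refine ⟨by rw [hmid]; exact subset_union_left, hmr, ?_, ?_⟩
  · rw [← card_differ, differ_flipBits_self, hpc]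
  · have hsd : differ right z \ (differ left z ∪ pick left right) =
        (differ right z \ differ left z) \ pick left right := by
      ext i; simp only [mem_sdiff, mem_union]; tauto
    rw [← card_differ, differ_eq_sdiff hmr, hmid, hsd, ← hdiff, card_sdiff_of_subset hp,
      card_differ, hpc]

lemma exists_differ_eq_singleton {left right : Point d} (hlr : differ left z ⊆ differ right z)
    (h : hammingDist left right = 1) :
    ∃ j ∈ agree left z, differ left right = {j} ∧ flipBits left {j} = right := by
  obtain ⟨j, hj⟩ := card_eq_one.1 ((card_differ left right).trans h)
  refine ⟨j, ?_, hj, ?_⟩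
  · have : j ∈ differ right z \ differ left z := by rw [← differ_eq_sdiff hlr, hj]; simp
    rw [agree_eq_compl, mem_compl]
    exact (mem_sdiff.1 this).2
  · rw [← hj]
    ext i
    by_cases hi : left i = right i
    · simp [flipBits, hi]
    · have : i ∈ differ left right := mem_differ.2 hi
      simp only [flipBits, this, if_true]
      revert hi
      cases left i <;> cases right i <;> simp

/-- The invariant is that `left` has a survivor and `right` has none. When they are adjacent,
flipping their common difference kills all survivors of `left`, so that bit is informative. -/
lemma failProb_binarySearch (hz : z ∈ P)
    (hP : ∀ p ∈ P, p ≠ z → 2 * R ≤ (hammingDist p z : ℝ)) (hpick : IsHalving pick) :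
    ∀ (fuel : ℕ) (left right : Point d), differ q₀ z ⊆ differ left z →
      differ left z ⊆ differ right z → (hammingDist right z : ℝ) ≤ R →
      hammingDist left right ≤ fuel → (survivors G z left).Nonempty →
      survivors G z right = ∅ → ∀ m,
      failProb (binarySearch pick (queryLSH tie P R G) z (fuel + 1) left right)
        (fun o => ∃ j, o = some {j} ∧ Informative G z q₀ j) m = 0 := by
  intro fuel
  induction fuel with
  | zero =>
    intro left right _ _ _ hfuel hl hr
    have : left = right := by
      rw [← hammingDist_eq_zero]; omega
    subst this
    simp [hr] at hl
  | succ fuel ih =>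
    intro left right hsub hlr hR hfuel hl hr m
    rw [binarySearch]
    split_ifs with h1
    · obtain ⟨hlm, hmr, hc1, hc2⟩ := hpick.midpoint hlr
      -- The midpoint is strictly closer to `z` than `right`, hence at distance less than `R`, where
      -- the answer of the oracle decides whether there are survivors.
      have hc3 : hammingDist (flipBits left (pick left right)) z < hammingDist right z := by
        have := card_sdiff_add_card_eq_card hmr
        rw [← differ_eq_sdiff hmr, card_differ, card_differ, card_differ] at this
        omega
      have hmR : (hammingDist (flipBits left (pick left right)) z : ℝ) < R :=
        lt_of_lt_of_le (by exact_mod_cast hc3) hR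
      rw [failProb_ask_bind]
      split_ifs with hQ
      · exact ih _ _ (hsub.trans hlm) hmr hR (by omega)
          (survivors_nonempty_of_queryLSH hQ) hr _
      · rw [queryLSH_eq_some_iff hz hP hmR, not_nonempty_iff_eq_empty] at hQ
        exact ih _ _ hsub hlm hmR.le (by omega) hl hQ _
    · have hne : hammingDist left right ≠ 0 := by
        rw [hammingDist_ne_zero]
        rintro rfl
        simp [hr] at hl
      obtain ⟨j, hja, hj, hflip⟩ := exists_differ_eq_singleton hlr (by omega)
      refine failProb_pure ⟨j, by rw [hj], ?_⟩ _
      exact informative_of_survivors hsub hja hl (hflip ▸ hr)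

/-- The search can fail only for a flip set that leaves a survivor, so the failure probability is at
most the mean number of survivors after flipping a random set. -/
lemma failProb_fastInner (hz : z ∈ P) (hP : ∀ p ∈ P, p ≠ z → 2 * R ≤ (hammingDist p z : ℝ))
    (hR : 0 ≤ R) (hRd : R ≤ d) (hpick : IsHalving pick) (hβ1 : β ≤ 1)
    (hβ : ∀ l ∈ survivors G z q₀, ((d - (coords (G l)).card : ℕ) : ℝ) ≤ β * d)
    (hq : (hammingDist q₀ z : ℝ) ≤ R) (hs : (survivors G z q₀).Nonempty) (m : ℕ) :
    failProb (fastInner pick (queryLSH tie P R G) z R q₀)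
      (fun o => ∃ j, o = some {j} ∧ Informative G z q₀ j) m ≤
      (survivors G z q₀).card * (β : ℝ≥0∞) ^ (⌊R⌋₊ - hammingDist q₀ z) := by
  have hqf : hammingDist q₀ z ≤ ⌊R⌋₊ := Nat.le_floor hq
  have hRd' : ⌊R⌋₊ ≤ d := Nat.floor_le_of_le hRd
  set a := ⌊R⌋₊ - hammingDist q₀ z with ha
  have hac : a ≤ (agree q₀ z).card := by rw [card_agree]; omega
  have hcard : 0 < ((agree q₀ z).powersetCard a).card := by
    rw [card_powersetCard]; exact Nat.choose_pos hac
  rw [fastInner, failProb_sample_bind (card_pos.1 hcard)]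
  have hstep : ∀ S ∈ (agree q₀ z).powersetCard a, failProb
      (do
        let b ← ask (queryLSH tie P R G) (flipBits q₀ S)
        if b = some z then pure none
        else binarySearch pick (queryLSH tie P R G) z (d + 1) q₀ (flipBits q₀ S))
      (fun o => ∃ j, o = some {j} ∧ Informative G z q₀ j) m ≤
      (survivors G z (flipBits q₀ S)).card := by
    intro S hS
    obtain ⟨hS, hSc⟩ := mem_powersetCard.1 hS
    rcases (survivors G z (flipBits q₀ S)).eq_empty_or_nonempty with he | he
    · have hQ : queryLSH tie P R G (flipBits q₀ S) ≠ some z := fun h => by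
        have := survivors_nonempty_of_queryLSH h
        simp [he] at this
      rw [failProb_ask_bind, if_neg hQ, failProb_binarySearch hz hP hpick _ _ _ subset_rfl _ _
        (hammingDist_le_dim _ _) hs he]
      · exact zero_le
      · rw [differ_flipBits hS]; exact subset_union_left
      · rw [hammingDist_flipBits hS, hSc, ha, Nat.add_sub_cancel' hqf]
        exact Nat.floor_le hR
    · refine (failProb_le_one _ _ _).trans ?_
      exact_mod_cast card_pos.2 he
  refine (ENNReal.div_le_div_right (sum_le_sum hstep) _).trans ?_
  rw [← Nat.cast_sum]
  have : ((survivors G z q₀).card : ℝ≥0∞) * (β : ℝ≥0∞) ^ a =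
      (((survivors G z q₀).card * β ^ a : ℝ≥0) : ℝ≥0∞) := by
    push_cast; rfl
  rw [this]
  refine natCast_div_le_coe ?_
  rw [sum_card_survivors_flipBits _ _ fun S hS => (mem_powersetCard.1 hS).1]
  push_cast
  rw [mul_assoc, ← nsmul_eq_mul]
  refine sum_le_card_nsmul _ _ _ fun l hl => ?_
  have hI := mem_survivors.1 hl
  have hf : ((agree q₀ z).powersetCard a).filter (fun S => Disjoint (coords (G l)) S) =
      (agree q₀ z \ coords (G l)).powersetCard a := by
    ext S
    simp only [mem_filter, mem_powersetCard, subset_sdiff, disjoint_comm (a := S)]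
    tauto
  rw [hf, card_powersetCard, card_powersetCard, card_sdiff_of_subset hI]
  exact choose_le_pow_mul_choose β.2 hβ1 (sub_le_mul_of_le (by rw [card_agree]; omega)
    (card_le_card hI) (hβ l hl)) a

end Inner

/-! ### The outer loop -/

section Outer

variable {d k L : ℕ} {tie : TieBreak d k L} {P : Finset (Point d)} {R r lam : ℝ}
  {G : HashFamily d k L} {z q₀ : Point d} {ε : ℝ≥0∞}
  {inner : Point d → QueryM (Option (Finset (Fin d)))}

/-- The outputs which are false negatives. -/
def FalseNegative (Q : Point d → Option (Point d)) (z : Point d) (r : ℝ) (o : Option (Point d)) :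
    Prop :=
  ∃ q, o = some q ∧ (hammingDist q z : ℝ) ≤ r ∧ Q q = none

/-- Distance plus number of survivors never increases along successful passes: an informative flip
adds one to the distance and removes at least one survivor. So there are at most as many passes as
survivors, each failing with probability at most `ε`. -/
lemma failProb_outerLoop (hP : ∀ p ∈ P, p ≠ z → 2 * R ≤ (hammingDist p z : ℝ)) (hrR : r < R)
    (hinner : ∀ q, differ q₀ z ⊆ differ q z → (hammingDist q z : ℝ) ≤ r →
      (survivors G z q).Nonempty → ∀ m,
      failProb (inner q) (fun o => ∃ j, o = some {j} ∧ Informative G z q j) m ≤ ε) :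
    ∀ (fuel : ℕ) (q : Point d), differ q₀ z ⊆ differ q z → (survivors G z q).card ≤ fuel →
      ((hammingDist q z + (survivors G z q).card : ℕ) : ℝ) ≤ r → ∀ m,
      failProb (outerLoop (queryLSH tie P R G) z r inner (fuel + 1) q)
        (FalseNegative (queryLSH tie P R G) z r) m ≤ (survivors G z q).card * ε := by
  intro fuel
  have hreturn : ∀ (q : Point d) (m : ℕ),
      ((hammingDist q z + (survivors G z q).card : ℕ) : ℝ) ≤ r →
      queryLSH tie P R G q ≠ some z →
      failProb (pure (some q)) (FalseNegative (queryLSH tie P R G) z r) m ≤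
        (survivors G z q).card * ε := by
    intro q m hr hQ
    have hr' : (hammingDist q z : ℝ) ≤ r := by
      push_cast at hr
      have : (0 : ℝ) ≤ (survivors G z q).card := Nat.cast_nonneg _
      linarith
    rw [failProb_pure ⟨q, rfl, hr', queryLSH_eq_none hP (by linarith) hQ⟩]
    exact zero_le
  induction fuel with
  | zero =>
    intro q _ hs hr m
    have hQ : queryLSH tie P R G q ≠ some z := fun h => by
      have := card_pos.2 (survivors_nonempty_of_queryLSH h)
      omega
    rw [outerLoop, failProb_ask_bind, if_neg hQ]
    exact hreturn q _ hr hQ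
  | succ fuel ih =>
    intro q hsub hs hr m
    rw [outerLoop, failProb_ask_bind]
    split_ifs with hQ hrq
    -- The answer `z` exhibits a survivor, so the invariant gives a distance of at most `r - 1`, and
    -- the loop does not give up here.
    · have := card_pos.2 (survivors_nonempty_of_queryLSH hQ)
      have h1 : ((hammingDist q z + 1 : ℕ) : ℝ) ≤ r :=
        le_trans (by exact_mod_cast (by omega)) hr
      push_cast at h1
      linarith
    · have hne := survivors_nonempty_of_queryLSH hQ
      obtain ⟨s, hcs⟩ : ∃ s, (survivors G z q).card = s + 1 :=
        ⟨_, (Nat.sub_add_cancel (card_pos.2 hne)).symm⟩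
      rw [hcs, Nat.cast_succ, add_mul, one_mul, add_comm _ ε]
      refine (failProb_bind_le (ok := fun o => ∃ j, o = some {j} ∧ Informative G z q j)
        (ε := s * ε) ?_).trans (add_le_add_left (hinner q hsub (not_le.1 hrq).le hne _) _)
      rintro _ ⟨j, rfl, hj⟩ m'
      have hlt := hj.card_survivors_lt
      have hd := hammingDist_flipBits_singleton hj.1
      refine (ih (flipBits q {j}) ?_ (by omega) (le_trans ?_ hr) m').trans ?_
      · rw [differ_flipBits (singleton_subset_iff.2 hj.1)]
        exact hsub.trans subset_union_left
      · exact_mod_cast (by omega)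
      · refine mul_le_mul_left ?_ _
        exact_mod_cast (by omega)
    · exact hreturn q _ hr hQ

end Outer

/-! ### Averaging over the hash functions and the starting point -/

section Attack

variable {d k L : ℕ} {tie : TieBreak d k L} {P : Finset (Point d)} {R r lam : ℝ}
  {z : Point d}

lemma attack_compl_successEvent [NeZero d] (tie : TieBreak d k L) (P : Finset (Point d)) (R r : ℝ)
    (z : Point d) (adversary : (Point d → Option (Point d)) → QueryM (Option (Point d))) :
    (attack tie P R adversary).toOuterMeasure (successEvent tie P R r z)ᶜ =
      (∑ G : HashFamily d k L, failProb (adversary (queryLSH tie P R G))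
        (FalseNegative (queryLSH tie P R G) z r) 0) / Fintype.card (HashFamily d k L) := by
  rw [attack, PMF.toOuterMeasure_bind_apply, tsum_fintype, ENNReal.div_eq_inv_mul, mul_sum]
  refine sum_congr rfl fun G _ => ?_
  rw [PMF.uniformOfFintype_apply, PMF.toOuterMeasure_map_apply]
  rfl

lemma failProb_walk {Q : Point d → Option (Point d)}
    {inner : Point d → QueryM (Option (Finset (Fin d)))} {good : Option (Point d) → Prop}
    (hs : ⌊r - offset lam⌋₊ ≤ d) (m : ℕ) :
    failProb (walk Q z r lam inner) good m =
      (∑ q ∈ sphere z ⌊r - offset lam⌋₊, failProb (outerLoop Q z r inner (d + 1) q) good m) /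
        (sphere z ⌊r - offset lam⌋₊).card := by
  rw [walk, failProb_sample_bind (sphere_nonempty z hs)]

lemma attack_walk_compl_successEvent_le [NeZero d]
    {inner : (Point d → Option (Point d)) → Point d → QueryM (Option (Finset (Fin d)))}
    (hs : ⌊r - offset lam⌋₊ ≤ d) (bad : Point d → HashFamily d k L → Prop)
    [∀ q, DecidablePred (bad q)] {δ ε : ℝ≥0∞}
    (hδ : ∀ q ∈ sphere z ⌊r - offset lam⌋₊,
      ((univ.filter (bad q)).card : ℝ≥0∞) ≤ δ * Fintype.card (HashFamily d k L))
    (hε : ∀ G, ∀ q ∈ sphere z ⌊r - offset lam⌋₊, ¬ bad q G → ∀ m,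
      failProb (outerLoop (queryLSH tie P R G) z r (inner (queryLSH tie P R G)) (d + 1) q)
        (FalseNegative (queryLSH tie P R G) z r) m ≤ ε) :
    (attack tie P R fun Q => walk Q z r lam (inner Q)).toOuterMeasure
      (successEvent tie P R r z)ᶜ ≤ δ + ε := by
  rw [attack_compl_successEvent]
  simp_rw [failProb_walk (z := z) hs]
  refine ENNReal.div_le_of_le_mul ?_
  simp_rw [ENNReal.div_eq_inv_mul]
  rw [← mul_sum, ← ENNReal.div_eq_inv_mul]
  refine ENNReal.div_le_of_le_mul ?_
  rw [sum_comm, mul_comm _ ((#(sphere z ⌊r - offset lam⌋₊) : ℕ) : ℝ≥0∞), ← nsmul_eq_mul]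
  refine sum_le_card_nsmul _ _ _ fun q hq => ?_
  calc ∑ G, failProb (outerLoop (queryLSH tie P R G) z r (inner (queryLSH tie P R G)) (d + 1) q)
        (FalseNegative (queryLSH tie P R G) z r) 0
      ≤ ∑ G : HashFamily d k L, ((if bad q G then 1 else 0) + ε) := by
        refine sum_le_sum fun G _ => ?_
        split_ifs with hb
        · exact (failProb_le_one _ _ _).trans le_self_add
        · rw [zero_add]; exact hε G q hq hb 0
    _ = (univ.filter (bad q)).card + Fintype.card (HashFamily d k L) * ε := by
        rw [sum_add_distrib, sum_boole, sum_const, nsmul_eq_mul, card_univ]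
    _ ≤ _ := by
        rw [add_mul, mul_comm ε]
        exact add_le_add_left (hδ q hq) _

lemma le_toOuterMeasure_of_compl_le {γ : Type*} {p : PMF γ} {s : Set γ}
    (h : p.toOuterMeasure sᶜ ≤ 3 / 4) {x : ℝ} (hx : x ≤ 1 / 4) :
    ENNReal.ofReal x ≤ p.toOuterMeasure s := by
  have h1 : 1 ≤ p.toOuterMeasure s + p.toOuterMeasure sᶜ := by
    rw [← toOuterMeasure_univ p, ← Set.union_compl_self s]
    exact MeasureTheory.measure_union_le _ _
  have h34 : (3 / 4 : ℝ≥0∞) = ENNReal.ofReal (3 / 4) := by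
    rw [ENNReal.ofReal_div_of_pos (by norm_num)]; simp
  calc ENNReal.ofReal x ≤ ENNReal.ofReal (1 - 3 / 4) :=
        ENNReal.ofReal_le_ofReal (by linarith)
    _ = 1 - 3 / 4 := by rw [ENNReal.ofReal_sub _ (by norm_num), h34, ENNReal.ofReal_one]
    _ ≤ 1 - p.toOuterMeasure sᶜ := tsub_le_tsub_left h _
    _ ≤ _ := tsub_le_iff_right.2 h1

end Attack

/-! ### First moments for random hash functions -/

section HashCounting

/-- One member of a uniform family is uniform: exchanging the value at `l` with an extra value `h`
is injective. -/
lemma card_filter_apply_mul_card {ι H : Type*} [Fintype ι] [DecidableEq ι] [Fintype H]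
    (p : H → Prop) [DecidablePred p] (l : ι) :
    (univ.filter fun G : ι → H => p (G l)).card * Fintype.card H ≤
      (univ.filter p).card * Fintype.card (ι → H) := by
  rw [← card_univ, ← card_univ, ← card_product, ← card_product]
  refine card_le_card_of_injOn (fun x => (x.1 l, Function.update x.1 l x.2)) ?_ ?_
  · intro x hx
    simpa using hx
  · rintro ⟨G, h⟩ - ⟨G', h'⟩ - heq
    simp only [Prod.mk.injEq] at heq
    obtain ⟨h1, h2⟩ := heq
    have h3 := congrFun h2 l
    simp only [Function.update_self] at h3
    refine Prod.ext (funext fun i => ?_) h3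
    by_cases hi : i = l
    · subst hi; exact h1
    · simpa [hi] using congrFun h2 i

variable {d k : ℕ}

lemma card_filter_coords_subset (A : Finset (Fin d)) :
    (univ.filter fun g : Fin k → Fin d => coords g ⊆ A).card = A.card ^ k := by
  have : (univ.filter fun g : Fin k → Fin d => coords g ⊆ A) =
      Fintype.piFinset fun _ : Fin k => A := by
    ext g; simp [coords, subset_iff]
  rw [this, Fintype.card_piFinset]
  simp

/-- Given that all coordinates lie in `A`, two of them coincide with probability at most `1/|A|`.
Overwriting the `i`-th one by an arbitrary element of `A` is injective, since the lost value is
still stored at `j`. -/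
lemma card_filter_collision_mul_card (A : Finset (Fin d)) {i j : Fin k} (hij : i ≠ j) :
    (univ.filter fun g : Fin k → Fin d => coords g ⊆ A ∧ g i = g j).card * A.card ≤
      A.card ^ k := by
  rw [← card_filter_coords_subset A, ← card_product]
  refine card_le_card_of_injOn (fun x => Function.update x.1 i x.2) ?_ ?_
  · rintro ⟨g, a⟩ hx
    simp only [coe_product, coe_filter, mem_univ, true_and, Set.mem_prod, Set.mem_ofPred_eq,
      mem_coe, coords, subset_iff, mem_image, forall_exists_index, forall_apply_eq_imp_iff] at hx ⊢
    intro b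
    by_cases hb : b = i
    · subst hb; simpa using hx.2
    · simpa [hb] using hx.1.1 b
  · rintro ⟨g, a⟩ hx ⟨g', a'⟩ hx' heq
    simp only [coe_product, coe_filter, mem_univ, true_and, Set.mem_prod, Set.mem_ofPred_eq,
      mem_coe] at hx hx' heq
    have h0 : ∀ b, b ≠ i → g b = g' b := fun b hb => by simpa [hb] using congrFun heq b
    refine Prod.ext (funext fun b => ?_) (by simpa using congrFun heq i)
    by_cases hb : b = i
    · subst hb
      show g b = g' b
      rw [hx.1.2, hx'.1.2, h0 j hij.symm]
    · exact h0 b hb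

lemma le_card_coords_add_card_collisions (g : Fin k → Fin d) :
    k ≤ (coords g).card +
      ((univ : Finset (Fin k)).offDiag.filter fun x => g x.1 = g x.2).card := by
  -- `W` consists of the positions that collide with another one; `g` is injective off `W`.
  set W := ((univ : Finset (Fin k)).offDiag.filter fun x => g x.1 = g x.2).image Prod.fst
  have h1 : W.card ≤ _ := card_image_le
  have h2 : Wᶜ.card ≤ (coords g).card := by
    rw [← card_image_of_injOn (s := Wᶜ) (f := g)]
    · exact card_le_card (image_subset_image (subset_univ _))
    · intro i hi j _ hij
      by_contra hne
      refine (mem_compl.1 (mem_coe.1 hi)) (mem_image.2 ⟨(i, j), ?_, rfl⟩)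
      simp [hne, hij]
  have h3 := card_add_card_compl W
  rw [Fintype.card_fin] at h3
  omega

/-- Markov's inequality for the number of ordered colliding pairs: its mean is at most `k²/|A|`,
while fewer than `3k/4` distinct coordinates force more than `k/4` such pairs. -/
lemma card_filter_few_coords_mul_card (hk : 0 < k) (A : Finset (Fin d)) :
    (univ.filter fun g : Fin k → Fin d =>
      coords g ⊆ A ∧ 4 * (coords g).card < 3 * k).card * A.card ≤ 4 * k * A.card ^ k := by
  set B := univ.filter fun g : Fin k → Fin d => coords g ⊆ A ∧ 4 * (coords g).card < 3 * k
  set S := univ.filter fun g : Fin k → Fin d => coords g ⊆ A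
  have hBS : B ⊆ S := fun g hg => by
    simp only [B, S, mem_filter, mem_univ, true_and] at hg ⊢; exact hg.1
  have h1 : B.card * k ≤ 4 * ∑ g ∈ S,
      ((univ : Finset (Fin k)).offDiag.filter fun x => g x.1 = g x.2).card := by
    rw [mul_sum]
    refine le_trans ?_ (sum_le_sum_of_subset hBS)
    rw [← smul_eq_mul]
    refine card_nsmul_le_sum _ _ _ fun g hg => ?_
    simp only [B, mem_filter, mem_univ, true_and] at hg
    have := le_card_coords_add_card_collisions g
    omega
  have h2 : ∑ g ∈ S, ((univ : Finset (Fin k)).offDiag.filter fun x => g x.1 = g x.2).card =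
      ∑ x ∈ (univ : Finset (Fin k)).offDiag,
        (univ.filter fun g : Fin k → Fin d => coords g ⊆ A ∧ g x.1 = g x.2).card := by
    refine (sum_card_bipartiteAbove_eq_sum_card_bipartiteBelow
      (fun (g : Fin k → Fin d) (x : Fin k × Fin k) => g x.1 = g x.2)).trans ?_
    refine sum_congr rfl fun x _ => congrArg card ?_
    ext g
    simp [S, bipartiteBelow]
  have h3 : (∑ x ∈ (univ : Finset (Fin k)).offDiag,
      (univ.filter fun g : Fin k → Fin d => coords g ⊆ A ∧ g x.1 = g x.2).card) * A.card ≤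
      k * k * A.card ^ k := by
    rw [sum_mul]
    calc _ ≤ (univ : Finset (Fin k)).offDiag.card • A.card ^ k :=
          sum_le_card_nsmul _ _ _ fun x hx =>
            card_filter_collision_mul_card A (mem_offDiag.1 hx).2.2
      _ ≤ _ := by
          rw [smul_eq_mul, offDiag_card, card_univ, Fintype.card_fin]
          exact Nat.mul_le_mul_right _ (Nat.sub_le _ _)
  refine Nat.le_of_mul_le_mul_right ?_ hk
  calc B.card * A.card * k = (B.card * k) * A.card := by ring
    _ ≤ (4 * ∑ g ∈ S, _) * A.card := Nat.mul_le_mul_right _ h1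
    _ = 4 * ((∑ g ∈ S, _) * A.card) := by ring
    _ ≤ 4 * (k * k * A.card ^ k) := by rw [h2]; exact Nat.mul_le_mul_left _ h3
    _ = _ := by ring

variable {L : ℕ}

lemma sum_card_filter_le [NeZero d] (p : (Fin k → Fin d) → Prop) [DecidablePred p] :
    (∑ G : HashFamily d k L, ((univ.filter fun l => p (G l)).card : ℝ)) ≤
      L * ((univ.filter p).card / (d : ℝ) ^ k) * Fintype.card (HashFamily d k L) := by
  have h := sum_card_bipartiteAbove_eq_sum_card_bipartiteBelow (s := (univ : Finset
    (HashFamily d k L))) (t := (univ : Finset (Fin L))) (fun G l => p (G l))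
  simp only [bipartiteAbove, bipartiteBelow] at h
  have hd : (0 : ℝ) < (d : ℝ) ^ k := pow_pos (by exact_mod_cast NeZero.pos d) _
  rw [← Nat.cast_sum, h, Nat.cast_sum]
  calc ∑ l : Fin L, ((univ.filter fun G : HashFamily d k L => p (G l)).card : ℝ)
      ≤ ∑ _l : Fin L, ((univ.filter p).card / (d : ℝ) ^ k) * Fintype.card (HashFamily d k L) := by
        refine sum_le_sum fun l _ => ?_
        rw [div_mul_eq_mul_div, le_div_iff₀ hd]
        have := card_filter_apply_mul_card (ι := Fin L) p l
        have hH : Fintype.card (Fin k → Fin d) = d ^ k := by simp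
        rw [hH] at this
        exact_mod_cast this
    _ = _ := by
        rw [sum_const, card_univ, Fintype.card_fin, nsmul_eq_mul, mul_assoc]

lemma survivors_eq_filter (G : HashFamily d k L) (z q : Point d) :
    survivors G z q = univ.filter fun l => coords (G l) ⊆ agree q z := by
  ext l; simp [mem_survivors]

/-- Markov's inequality for the number of hash functions under which `q` collides with `z`. -/
lemma card_filter_many_survivors_mul_le [NeZero d] (z q : Point d) (T : ℝ) :
    ((univ.filter fun G : HashFamily d k L => T ≤ (survivors G z q).card).card : ℝ) * T ≤
      L * ((agree q z).card / (d : ℝ)) ^ k * Fintype.card (HashFamily d k L) := by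
  have h := sum_card_filter_le (L := L) (fun g : Fin k → Fin d => coords g ⊆ agree q z)
  simp_rw [← survivors_eq_filter] at h
  rw [card_filter_coords_subset, Nat.cast_pow, ← div_pow] at h
  refine le_trans ?_ h
  rw [← nsmul_eq_mul]
  refine (card_nsmul_le_sum _ (fun G => ((survivors G z q).card : ℝ)) T fun G hG => ?_).trans
    (sum_le_sum_of_subset_of_nonneg (filter_subset _ _) fun _ _ _ => Nat.cast_nonneg _)
  exact (mem_filter.1 hG).2

lemma card_filter_few_coords_le [NeZero d] (hk : 0 < k) (z q : Point d) :
    ((univ.filter fun G : HashFamily d k L =>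
      ∃ l ∈ survivors G z q, 4 * (coords (G l)).card < 3 * k).card : ℝ) * (agree q z).card ≤
      4 * k * (L * ((agree q z).card / (d : ℝ)) ^ k) * Fintype.card (HashFamily d k L) := by
  set p := fun g : Fin k → Fin d => coords g ⊆ agree q z ∧ 4 * (coords g).card < 3 * k
  have h := sum_card_filter_le (L := L) p
  have hd : (0 : ℝ) < (d : ℝ) ^ k := pow_pos (by exact_mod_cast NeZero.pos d) _
  have h1 : ((univ.filter fun G : HashFamily d k L =>
      ∃ l ∈ survivors G z q, 4 * (coords (G l)).card < 3 * k).card : ℝ) ≤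
      ∑ G : HashFamily d k L, ((univ.filter fun l => p (G l)).card : ℝ) := by
    have h2 := card_nsmul_le_sum (univ.filter fun G : HashFamily d k L =>
      ∃ l ∈ survivors G z q, 4 * (coords (G l)).card < 3 * k)
      (fun G => ((univ.filter fun l => p (G l)).card : ℝ)) 1 (fun G hG => by
        obtain ⟨l, hl, hc⟩ := (mem_filter.1 hG).2
        have : 0 < (univ.filter fun l => p (G l)).card :=
          card_pos.2 ⟨l, by simp only [p, mem_filter, mem_univ, true_and]
                            exact ⟨mem_survivors.1 hl, hc⟩⟩
        exact_mod_cast this)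
    rw [nsmul_eq_mul, mul_one] at h2
    exact h2.trans
      (sum_le_sum_of_subset_of_nonneg (filter_subset _ _) fun _ _ _ => Nat.cast_nonneg _)
  have h3 : ((univ.filter p).card : ℝ) * (agree q z).card ≤ 4 * k * (agree q z).card ^ k := by
    exact_mod_cast card_filter_few_coords_mul_card hk (agree q z)
  calc _ ≤ (L * ((univ.filter p).card / (d : ℝ) ^ k) * Fintype.card (HashFamily d k L)) *
        (agree q z).card := mul_le_mul_of_nonneg_right (h1.trans h) (Nat.cast_nonneg _)
    _ = L * Fintype.card (HashFamily d k L) / (d : ℝ) ^ k *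
        ((univ.filter p).card * (agree q z).card) := by ring
    _ ≤ L * Fintype.card (HashFamily d k L) / (d : ℝ) ^ k *
        (4 * k * (agree q z).card ^ k) := mul_le_mul_of_nonneg_left h3 (by positivity)
    _ = _ := by rw [div_pow]; ring

end HashCounting

/-! ### Numerical consequences of the parameter ranges -/

section Parameters

/-- The admissible ranges of the parameters. -/
structure Admissible (n d : ℕ) (r c lam : ℝ) : Prop where
  one_lt : Real.exp 1 < n
  le_r : 28 * Real.log n ^ 3 ≤ r
  r_le : r ≤ d / (28 * Real.log n)
  lam_nonneg : 0 ≤ lam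
  lam_le : lam ≤ 1 / (8 * Real.exp 1 ^ 2) * min (r / Real.log n) ((n : ℝ) ^ (1 / 8 : ℝ)) - 1
  le_c : 1 + (80 + 16 * Real.log (lam + 1)) / Real.log n ≤ c
  c_le : c ≤ Real.log n

namespace Admissible

variable {n d : ℕ} {r c lam : ℝ}

/-- Since `e² ≤ 8`, the upper bound on `λ` gives `e⁴ (λ + 1) ≤ n^(1/8)`; take logarithms. With `λ ≥
0` this makes `n` at least `e³²`. -/
lemma log_bounds (h : Admissible n d r c lam) :
    32 ≤ Real.log n ∧ Real.log (lam + 1) ≤ Real.log n / 8 - 4 := by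
  have hn : (0 : ℝ) < n := (Real.exp_pos 1).trans h.one_lt
  have he : (0 : ℝ) < 8 * Real.exp 1 ^ 2 := by positivity
  have h1 : (8 * Real.exp 1 ^ 2) * (lam + 1) ≤ (n : ℝ) ^ (1 / 8 : ℝ) := by
    have h2 : lam + 1 ≤ 1 / (8 * Real.exp 1 ^ 2) * (n : ℝ) ^ (1 / 8 : ℝ) := by
      have := mul_le_mul_of_nonneg_left
        (min_le_right (r / Real.log n) ((n : ℝ) ^ (1 / 8 : ℝ))) (one_div_pos.2 he).le
      linarith [h.lam_le]
    rw [one_div_mul_eq_div, le_div_iff₀ he] at h2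
    linarith
  have hlam : 0 < lam + 1 := by linarith [h.lam_nonneg]
  have h4 : Real.exp 4 ≤ 8 * Real.exp 1 ^ 2 := by
    have : Real.exp 4 = Real.exp 1 ^ 2 * Real.exp 1 ^ 2 := by
      rw [← Real.exp_nat_mul, ← Real.exp_add]; norm_num
    have h8 : Real.exp 1 ^ 2 ≤ 8 := by
      nlinarith [Real.exp_one_lt_d9, Real.exp_pos 1]
    rw [this]
    exact mul_le_mul_of_nonneg_right h8 (by positivity)
  have h5 : Real.exp 4 * (lam + 1) ≤ (n : ℝ) ^ (1 / 8 : ℝ) :=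
    (mul_le_mul_of_nonneg_right h4 hlam.le).trans h1
  have h6 := Real.log_le_log (by positivity) h5
  rw [Real.log_mul (Real.exp_ne_zero _) hlam.ne', Real.log_exp, Real.log_rpow hn] at h6
  have h7 : 0 ≤ Real.log (lam + 1) := Real.log_nonneg (by linarith [h.lam_nonneg])
  constructor <;> linarith

lemma log_lam_nonneg (h : Admissible n d r c lam) : 0 ≤ Real.log (lam + 1) :=
  Real.log_nonneg (by linarith [h.lam_nonneg])

lemma r_large (h : Admissible n d r c lam) : 28 * 32 * 32 * Real.log n ≤ r := by
  have h1 := h.log_bounds.1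
  refine le_trans ?_ h.le_r
  have : 32 * 32 ≤ Real.log n ^ 2 := by nlinarith
  nlinarith

lemma r_pos (h : Admissible n d r c lam) : 0 < r := by
  linarith [h.r_large, h.log_bounds.1]

lemma r_mul_log_le (h : Admissible n d r c lam) : 28 * Real.log n * r ≤ d := by
  have h1 := h.log_bounds.1
  have := (le_div_iff₀ (by linarith : 0 < 28 * Real.log n)).1 h.r_le
  linarith

lemma r_le_dim (h : Admissible n d r c lam) : 28 * 32 * r ≤ d := by
  refine le_trans ?_ h.r_mul_log_le
  have := mul_le_mul_of_nonneg_right h.log_bounds.1 h.r_pos.le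
  linarith

lemma dim_pos (h : Admissible n d r c lam) : (0 : ℝ) < d := by
  linarith [h.r_le_dim, h.r_pos]

lemma log_mul_c_sub_one (h : Admissible n d r c lam) :
    80 + 16 * Real.log (lam + 1) ≤ Real.log n * (c - 1) := by
  have h1 := h.log_bounds.1
  have h2 : (80 + 16 * Real.log (lam + 1)) / Real.log n ≤ c - 1 := by linarith [h.le_c]
  rw [div_le_iff₀ (by linarith)] at h2
  linarith

lemma one_lt_c (h : Admissible n d r c lam) : 1 < c := by
  have h1 := h.log_bounds.1
  have h2 := h.log_mul_c_sub_one
  have h3 := h.log_lam_nonneg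
  have : 0 < Real.log n * (c - 1) := by linarith
  have := (mul_pos_iff_of_pos_left (by linarith : 0 < Real.log n)).1 this
  linarith

lemma c_mul_log_bound (h : Admissible n d r c lam) :
    c * (16 + 4 * Real.log (lam + 1)) ≤ Real.log n * (c - 1) := by
  obtain ⟨h1, h2⟩ := h.log_bounds
  have h3 := h.log_lam_nonneg
  have h4 := h.log_mul_c_sub_one
  have hc := h.one_lt_c
  -- For `c ≤ 2` the lower bound on `c` suffices; for `c ≥ 2` use `c - 1 ≥ c/2` and `log n ≥ 32 + 8
  -- log (λ + 1)`.
  rcases le_total c 2 with h5 | h5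
  · nlinarith
  · nlinarith

lemma lam_le_r (h : Admissible n d r c lam) :
    8 * Real.exp 1 ^ 2 * (lam + 1) * Real.log n ≤ r := by
  have he : (0 : ℝ) < 8 * Real.exp 1 ^ 2 := by positivity
  have h1 := h.log_bounds.1
  have h2 : lam + 1 ≤ 1 / (8 * Real.exp 1 ^ 2) * (r / Real.log n) := by
    have := mul_le_mul_of_nonneg_left
      (min_le_left (r / Real.log n) ((n : ℝ) ^ (1 / 8 : ℝ))) (one_div_pos.2 he).le
    linarith [h.lam_le]
  rw [one_div_mul_eq_div, le_div_iff₀ he, le_div_iff₀ (by linarith)] at h2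
  linarith

lemma offset_mul_log_le (h : Admissible n d r c lam) : 4 * offset lam * Real.log n ≤ r := by
  have := h.lam_le_r
  unfold offset
  linarith

lemma offset_pos (h : Admissible n d r c lam) : 0 < offset lam := by
  have := h.lam_nonneg
  unfold offset
  positivity

lemma offset_le (h : Admissible n d r c lam) : offset lam + 1 ≤ 16 * (lam + 1) := by
  have h8 : 2 * Real.exp 1 ^ 2 ≤ 15 := by
    nlinarith [Real.exp_one_lt_d9, Real.exp_pos 1]
  have := h.lam_nonneg
  have := mul_le_mul_of_nonneg_right h8 (by linarith : 0 ≤ lam + 1)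
  unfold offset
  linarith

lemma offset_le_r (h : Admissible n d r c lam) : offset lam ≤ r := by
  have h1 := h.log_bounds.1
  have h2 := h.offset_pos
  have := h.offset_mul_log_le
  nlinarith

lemma start_bounds (h : Admissible n d r c lam) :
    r - offset lam - 1 < ⌊r - offset lam⌋₊ ∧ (⌊r - offset lam⌋₊ : ℝ) ≤ r - offset lam :=
  ⟨Nat.sub_one_lt_floor _, Nat.floor_le (by linarith [h.offset_le_r])⟩

lemma start_le_dim (h : Admissible n d r c lam) : ⌊r - offset lam⌋₊ ≤ d := by
  have : (⌊r - offset lam⌋₊ : ℝ) ≤ d := by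
    linarith [h.start_bounds.2, h.offset_pos, h.r_le_dim, h.r_pos]
  exact_mod_cast this

lemma r_lt (h : Admissible n d r c lam) : r < c * r :=
  lt_mul_of_one_lt_left h.r_pos h.one_lt_c

lemma cr_le (h : Admissible n d r c lam) : 28 * (c * r) ≤ d := by
  have := mul_le_mul_of_nonneg_right h.c_le h.r_pos.le
  linarith [h.r_mul_log_le]

/-- Both bounds say `k · cr/d ≈ log n`. With `x = cr/d ≤ 1/28` and `y = -log (1 - x)` one has `x ≤ y
≤ x/(1 - x)`, which costs the factor `27/28`; rounding `k` up adds at most `x`, absorbed by `1.002`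
because `log n ≥ 32`. -/
lemma hashLen_bounds (h : Admissible n d r c lam) :
    27 / 28 * Real.log n * d ≤ hashLen n d r c * (c * r) ∧
      hashLen n d r c * (c * r) ≤ 1.002 * Real.log n * d := by
  have hℓ := h.log_bounds.1
  have hd := h.dim_pos
  set x := c * r / d with hx
  have hcr : 0 < c * r := h.r_pos.trans h.r_lt
  have hx0 : 0 < x := div_pos hcr hd
  have hx1 : x ≤ 1 / 28 := by rw [hx, div_le_iff₀ hd]; linarith [h.cr_le]
  have hxd : x * d = c * r := by rw [hx]; field_simp
  have hk : hashLen n d r c = ⌈Real.log n / -Real.log (1 - x)⌉₊ := by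
    rw [hashLen, Real.logb, one_div, Real.log_inv]
  set y := -Real.log (1 - x) with hy
  have hy1 : x ≤ y := by
    have := Real.log_le_sub_one_of_pos (by linarith : 0 < 1 - x)
    linarith
  have hy2 : y * (1 - x) ≤ x := by
    have h1 := Real.one_sub_inv_le_log_of_pos (by linarith : 0 < 1 - x)
    have h2 : y ≤ (1 - x)⁻¹ - 1 := by linarith
    have h3 := mul_le_mul_of_nonneg_right h2 (by linarith : 0 ≤ 1 - x)
    rw [sub_mul, inv_mul_cancel₀ (by linarith)] at h3
    linarith
  have hy0 : 0 < y := hx0.trans_le hy1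
  have hk1 : Real.log n ≤ hashLen n d r c * y := by
    rw [← div_le_iff₀ hy0, hk]; exact Nat.le_ceil _
  have hk2 : (hashLen n d r c : ℝ) * y ≤ Real.log n + y := by
    have := (Nat.ceil_lt_add_one (a := Real.log n / y) (by positivity)).le
    rw [← hk] at this
    calc _ ≤ (Real.log n / y + 1) * y := mul_le_mul_of_nonneg_right this hy0.le
      _ = _ := by field_simp
  have hk0 : (0 : ℝ) ≤ hashLen n d r c := Nat.cast_nonneg _
  have e1 : 27 / 28 * Real.log n ≤ hashLen n d r c * x := by
    have h1 := mul_le_mul_of_nonneg_left hy2 hk0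
    have h2 := mul_le_mul_of_nonneg_right hk1 (by linarith : 0 ≤ 1 - x)
    nlinarith
  have e2 : (hashLen n d r c : ℝ) * x ≤ 1.002 * Real.log n := by
    have h1 : ((hashLen n d r c : ℝ) - 1) * x ≤ Real.log n := by
      rcases le_total (hashLen n d r c : ℝ) 1 with h3 | h3
      · nlinarith
      · have := mul_le_mul_of_nonneg_left hy1 (by linarith : (0 : ℝ) ≤ hashLen n d r c - 1)
        linarith
    norm_num
    linarith
  constructor
  · have := mul_le_mul_of_nonneg_right e1 hd.le
    rwa [mul_assoc _ x, hxd] at this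
  · have := mul_le_mul_of_nonneg_right e2 hd.le
    rwa [mul_assoc _ x, hxd] at this

lemma hashLen_mul_r_le (h : Admissible n d r c lam) :
    hashLen n d r c * r ≤ 1.002 * Real.log n * d :=
  (mul_le_mul_of_nonneg_left h.r_lt.le (Nat.cast_nonneg _)).trans h.hashLen_bounds.2

lemma hashLen_pos (h : Admissible n d r c lam) : 0 < hashLen n d r c := by
  have h1 := h.hashLen_bounds.1
  have hℓ := h.log_bounds.1
  have hd := h.dim_pos
  rcases Nat.eq_zero_or_pos (hashLen n d r c) with h0 | h0
  · rw [h0] at h1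
    have : 0 < 27 / 28 * Real.log n * d := by positivity
    push_cast at h1
    linarith
  · exact h0

/-- The expected number of collisions at distance `r` is at most `λ + 1`. -/
lemma numHashes_mul_pow_le (h : Admissible n d r c lam) :
    numHashes n d r c lam * (1 - r / d) ^ hashLen n d r c ≤ lam + 1 := by
  have hd := h.dim_pos
  have hr := h.r_pos
  have hn : (0 : ℝ) < n := (Real.exp_pos 1).trans h.one_lt
  have hℓ := h.log_bounds.1
  have hcr : 0 < c * r := hr.trans h.r_lt
  have hx1 : c * r / d < 1 := by rw [div_lt_one hd]; linarith [h.cr_le]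
  have hx0 : 0 < c * r / d := div_pos hcr hd
  have hp1 : r / d < 1 := by rw [div_lt_one hd]; linarith [h.r_le_dim]
  have hp0 : 0 < r / d := div_pos hr hd
  have hp : 0 < 1 - r / d := by linarith
  have hlogp : Real.log (1 - r / d) < 0 := Real.log_neg hp (by linarith)
  have hlogx : Real.log (1 - c * r / d) < 0 := Real.log_neg (by linarith) (by linarith)
  have hL : (numHashes n d r c lam : ℝ) ≤ lam * (n : ℝ) ^ rho d r c + 1 :=
    (Nat.ceil_lt_add_one (mul_nonneg h.lam_nonneg (Real.rpow_nonneg hn.le _))).le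
  -- By the choice of `ρ`, `p₁` raised to the power `log_{1/p₂} n` equals `n^(-ρ)`, and `k` is at
  -- least that exponent.
  have hpow : (n : ℝ) ^ rho d r c * (1 - r / d) ^ hashLen n d r c ≤ 1 := by
    rw [Real.rpow_def_of_pos hn, ← Real.exp_log hp, ← Real.exp_nat_mul,
      ← Real.exp_add, Real.exp_le_one_iff, rho, one_div, one_div, Real.log_inv, Real.log_inv]
    have hk : Real.log n / -Real.log (1 - c * r / d) ≤ hashLen n d r c := by
      rw [hashLen, Real.logb, one_div, Real.log_inv]
      exact Nat.le_ceil _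
    have := mul_le_mul_of_nonpos_right hk hlogp.le
    calc _ ≤ Real.log n * (-Real.log (1 - r / d) / -Real.log (1 - c * r / d)) +
          Real.log n / -Real.log (1 - c * r / d) * Real.log (1 - r / d) := by linarith
      _ = 0 := by ring
  have hpow1 : (1 - r / d) ^ hashLen n d r c ≤ 1 := pow_le_one₀ hp.le (by linarith)
  calc _ ≤ (lam * (n : ℝ) ^ rho d r c + 1) * (1 - r / d) ^ hashLen n d r c :=
        mul_le_mul_of_nonneg_right hL (by positivity)
    _ = lam * ((n : ℝ) ^ rho d r c * (1 - r / d) ^ hashLen n d r c) +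
        (1 - r / d) ^ hashLen n d r c := by ring
    _ ≤ lam * 1 + 1 := add_le_add (mul_le_mul_of_nonneg_left hpow h.lam_nonneg) hpow1
    _ = _ := by ring

/-- The expected number of collisions at the starting point is at most `e (λ + 1)`. -/
lemma numHashes_mul_start_le (h : Admissible n d r c lam) :
    numHashes n d r c lam * (((d - ⌊r - offset lam⌋₊ : ℕ) : ℝ) / d) ^ hashLen n d r c ≤
      Real.exp 1 * (lam + 1) := by
  have hd := h.dim_pos
  have hr := h.r_pos
  have hrd := h.r_le_dim
  have hℓ := h.log_bounds.1
  have ht := h.offset_pos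
  set k := hashLen n d r c
  have hdr : 0 < (d : ℝ) - r := by linarith
  -- Starting `t + 1` closer to `z` (with rounding) enlarges the proportion of agreeing bits by at
  -- most `1 + w ≤ e^w`; over `k` coordinates this costs at most a factor `e`, as `k w ≤ 1`.
  set w := (offset lam + 1) / (d - r) with hw
  have hbase : ((d - ⌊r - offset lam⌋₊ : ℕ) : ℝ) / d ≤ (1 - r / d) * Real.exp w := by
    rw [Nat.cast_sub h.start_le_dim]
    have h1 : (d : ℝ) - ⌊r - offset lam⌋₊ ≤ d - r + (offset lam + 1) := by
      linarith [h.start_bounds.1]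
    calc _ ≤ (d - r + (offset lam + 1)) / d := div_le_div_of_nonneg_right h1 hd.le
      _ = (1 - r / d) * (w + 1) := by rw [hw]; field_simp; ring
      _ ≤ _ := mul_le_mul_of_nonneg_left (Real.add_one_le_exp w) (by
          rw [sub_nonneg, div_le_one hd]; linarith)
  have hkw : k * w ≤ 1 := by
    rw [hw, ← mul_div_assoc, div_le_one hdr]
    have h1 := h.hashLen_mul_r_le
    have h2 := h.offset_mul_log_le
    have h3 := h.r_large
    have h4 : 3 * (offset lam + 1) * Real.log n ≤ r := by nlinarith
    have hk0 : (0 : ℝ) ≤ k := Nat.cast_nonneg _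
    have h5 := mul_le_mul_of_nonneg_left h4 hk0
    have h6 : (3 * (k * (offset lam + 1))) * Real.log n ≤ (1.002 * d) * Real.log n := by
      calc _ = k * (3 * (offset lam + 1) * Real.log n) := by ring
        _ ≤ k * r := h5
        _ ≤ _ := h1
        _ = _ := by ring
    have h7 := le_of_mul_le_mul_right h6 (by linarith)
    norm_num at h7
    linarith
  calc _ ≤ numHashes n d r c lam * ((1 - r / d) * Real.exp w) ^ k := by
        refine mul_le_mul_of_nonneg_left ?_ (Nat.cast_nonneg _)
        exact pow_le_pow_left₀ (by positivity) hbase _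
    _ = (numHashes n d r c lam * (1 - r / d) ^ k) * Real.exp (k * w) := by
        rw [mul_pow, Real.exp_nat_mul]; ring
    _ ≤ (lam + 1) * Real.exp 1 :=
        mul_le_mul h.numHashes_mul_pow_le (Real.exp_le_exp.2 hkw) (Real.exp_pos _).le
          (by linarith [h.lam_nonneg])
    _ = _ := mul_comm _ _

lemma few_coords_bound (h : Admissible n d r c lam) :
    4 * hashLen n d r c * (Real.exp 1 * (lam + 1)) ≤
      1 / 4 * ((d - ⌊r - offset lam⌋₊ : ℕ) : ℝ) := by
  rw [Nat.cast_sub h.start_le_dim]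
  have hd := h.dim_pos
  have hr := h.r_pos
  have hrd := h.r_le_dim
  have hℓ := h.log_bounds.1
  have ht := h.offset_pos
  have hlam := h.lam_nonneg
  have h1 := h.hashLen_mul_r_le
  have hk0 : (0 : ℝ) ≤ hashLen n d r c := Nat.cast_nonneg _
  have he := Real.exp_one_gt_d9
  -- The constant `21` comes from `8e > 21`.
  have h2 : 21 * (Real.exp 1 * (lam + 1)) * Real.log n ≤ r := by
    refine le_trans ?_ h.lam_le_r
    have : 0 ≤ Real.exp 1 * (lam + 1) * Real.log n := by positivity
    nlinarith
  have h3 : (21 * (hashLen n d r c * (Real.exp 1 * (lam + 1)))) * Real.log n ≤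
      (1.002 * d) * Real.log n := by
    calc _ = hashLen n d r c * (21 * (Real.exp 1 * (lam + 1)) * Real.log n) := by ring
      _ ≤ hashLen n d r c * r := mul_le_mul_of_nonneg_left h2 hk0
      _ ≤ _ := h1
      _ = _ := by ring
  have h4 := le_of_mul_le_mul_right h3 (by linarith)
  norm_num at h4
  linarith [h.start_bounds.2]

/-- The miss probability of a single random flip for a hash function reading many coordinates. -/
def missRate (d k : ℕ) : ℝ≥0 := ⟨Real.exp (-(3 * k / (4 * d))), (Real.exp_pos _).le⟩

lemma missRate_le_one (d k : ℕ) : missRate d k ≤ 1 := by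
  rw [← NNReal.coe_le_coe]
  change Real.exp (-(3 * k / (4 * d))) ≤ 1
  rw [Real.exp_le_one_iff, neg_nonpos]
  positivity

lemma sub_le_missRate_mul {d k m : ℕ} (hd : 0 < d) (hm : m ≤ d) (h : 3 * k ≤ 4 * m) :
    ((d - m : ℕ) : ℝ) ≤ missRate d k * d := by
  have hd' : (0 : ℝ) < d := by exact_mod_cast hd
  have h1 : -(3 * k / (4 * d) : ℝ) + 1 ≤ missRate d k := Real.add_one_le_exp _
  have h2 := mul_le_mul_of_nonneg_right h1 hd'.le
  have h3 : (3 * k : ℝ) ≤ 4 * m := by exact_mod_cast h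
  have h4 : (-(3 * k / (4 * d) : ℝ) + 1) * d = d - 3 * k / 4 := by field_simp; ring
  rw [Nat.cast_sub hm]
  linarith

/-- The outer `N` counts passes, the inner one survivors in each pass. Here `N ≤ t + 1 ≤ 16 (λ +
1)`, and the `b` flips give `β ^ b ≤ e^(-11) (λ + 1)^(-2)`, so the product is at most `256/e¹¹ ≤
1/4`. -/
lemma missRate_bound (h : Admissible n d r c lam) {N : ℕ}
    (hN : ((⌊r - offset lam⌋₊ + N : ℕ) : ℝ) ≤ r) :
    (N : ℝ) * (N * (missRate d (hashLen n d r c) : ℝ) ^ (⌊c * r⌋₊ - ⌊r⌋₊)) ≤ 1 / 4 := by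
  have hd := h.dim_pos
  have hr := h.r_pos
  have hcr := h.r_lt
  have hℓ := h.log_bounds.1
  have hlam := h.lam_nonneg
  have hk := h.hashLen_bounds.1
  have hc := h.c_mul_log_bound
  have hc1 := h.one_lt_c
  have hu := h.log_lam_nonneg
  set k := hashLen n d r c
  set u := Real.log (lam + 1)
  have hNle : (N : ℝ) ≤ 16 * Real.exp u := by
    rw [Real.exp_log (by linarith)]
    push_cast at hN
    linarith [h.start_bounds.1, h.offset_le]
  have hb : c * r - 1 - r ≤ ((⌊c * r⌋₊ - ⌊r⌋₊ : ℕ) : ℝ) := by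
    rw [Nat.cast_sub (Nat.floor_le_floor hcr.le)]
    linarith [Nat.sub_one_lt_floor (c * r), Nat.floor_le hr.le]
  set b := ⌊c * r⌋₊ - ⌊r⌋₊
  have hexp : 11 + 2 * u ≤ b * (3 * k / (4 * d)) := by
    rw [← mul_div_assoc, le_div_iff₀ (by linarith)]
    have h1 : r * (c * (16 + 4 * u)) ≤ r * (Real.log n * (c - 1)) :=
      mul_le_mul_of_nonneg_left hc hr.le
    -- Lowering `16` to `15.9` pays for the `-1` caused by the floors, since `log n` is at most `0.1
    -- · cr`. Later `3/4 · 27/28 · 15.9 > 11`.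
    have h2 : (c * r) * (15.9 + 4 * u) ≤ Real.log n * (c * r - 1 - r) := by
      have := h.r_large
      norm_num
      nlinarith
    have h3 : 0 ≤ (c * r - 1 - r) * d := by
      have : 0 ≤ c * r - 1 - r := by
        have h5 : 0 ≤ Real.log n * (c * r - 1 - r) :=
          le_trans (by have := hr.trans hcr; positivity) h2
        exact nonneg_of_mul_nonneg_right h5 (by linarith)
      positivity
    have h4 : 27 / 28 * ((c * r) * (15.9 + 4 * u)) * d ≤ (b * k) * (c * r) := by
      calc _ = 27 / 28 * d * ((c * r) * (15.9 + 4 * u)) := by ring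
        _ ≤ 27 / 28 * d * (Real.log n * (c * r - 1 - r)) :=
          mul_le_mul_of_nonneg_left h2 (by positivity)
        _ = (c * r - 1 - r) * (27 / 28 * Real.log n * d) := by ring
        _ ≤ b * (k * (c * r)) := by
          refine mul_le_mul hb hk (by positivity) (Nat.cast_nonneg _)
        _ = _ := by ring
    have h6 : (27 / 28 * (15.9 + 4 * u) * d) * (c * r) ≤ (b * k) * (c * r) := by
      refine le_trans (le_of_eq ?_) h4; ring
    have h7 := le_of_mul_le_mul_right h6 (hr.trans hcr)
    have h8 : 0 ≤ u * d := by positivity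
    norm_num at h7
    linarith
  have hpow : (missRate d k : ℝ) ^ b ≤ Real.exp (-(11 + 2 * u)) := by
    change Real.exp (-(3 * k / (4 * d))) ^ b ≤ _
    rw [← Real.exp_nat_mul, Real.exp_le_exp]
    linarith
  have h11 : 1024 ≤ Real.exp 11 := by
    have h2 : (2 : ℝ) ≤ Real.exp 1 := by linarith [Real.exp_one_gt_d9]
    calc (1024 : ℝ) ≤ 2 ^ 11 := by norm_num
      _ ≤ Real.exp 1 ^ 11 := pow_le_pow_left₀ (by norm_num) h2 _
      _ = Real.exp 11 := by rw [← Real.exp_nat_mul]; norm_num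
  calc (N : ℝ) * (N * (missRate d k : ℝ) ^ b)
      ≤ 16 * Real.exp u * (16 * Real.exp u * Real.exp (-(11 + 2 * u))) := by
        gcongr
    _ = 256 * (Real.exp u * Real.exp u * Real.exp (-(11 + 2 * u))) := by ring
    _ = 256 / Real.exp 11 := by
        rw [← Real.exp_add, ← Real.exp_add, div_eq_mul_inv, ← Real.exp_neg]
        congr 2; ring
    _ ≤ 1 / 4 := by
        rw [div_le_iff₀ (Real.exp_pos _)]; linarith

end Admissible

end Parameters

/-! ### Worst-case query counts -/

section Queries

variable {d : ℕ} {Q : Point d → Option (Point d)} {z q₀ : Point d} {R r lam : ℝ}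

lemma queriesLE_simpleInner :
    ∀ (fuel : ℕ) (last : Option (Fin d)) (q : Point d), differ q₀ z ⊆ differ q z →
      (hammingDist q z : ℝ) ≤ R → (∀ j ∈ last, j ∈ agree q₀ z) →
      QueriesLE (simpleInner Q z R fuel last q) (⌊R⌋₊ + 1 - hammingDist q z)
        (∀ j ∈ ·, j ∈ agree q₀ z) := by
  intro fuel
  induction fuel with
  | zero => intro last q _ _ _; exact queriesLE_pure (by simp) _
  | succ fuel ih =>
    intro last q hsub hq hlast
    have hqf : hammingDist q z ≤ ⌊R⌋₊ := Nat.le_floor hq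
    rw [simpleInner]
    refine ((queriesLE_ask Q q).bind (b' := ⌊R⌋₊ - hammingDist q z)
      (post := (∀ j ∈ ·, j ∈ agree q₀ z)) ?_).mono (by omega) fun _ h => h
    intro a _
    split_ifs
    · refine ((queriesLE_sample (agree q z)).bind (b' := ⌊R⌋₊ - hammingDist q z)
        (post := (∀ j ∈ ·, j ∈ agree q₀ z)) ?_).mono (by omega) fun _ h => h
      rintro (_ | j) hj
      · exact queriesLE_pure (by simp) _
      · have hj' : j ∈ agree q z := hj j rfl
        have hd := hammingDist_flipBits_singleton hj'
        simp only
        split_ifs with h1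
        · exact queriesLE_pure (by simp) _
        · have hle := not_lt.1 h1
          refine (ih (some j) (flipBits q {j}) ?_ hle ?_).mono (by omega) fun _ h => h
          · rw [differ_flipBits (singleton_subset_iff.2 hj')]
            exact hsub.trans subset_union_left
          · rintro i hi
            obtain rfl : j = i := by simpa using hi
            exact agree_antitone hsub hj'
    · exact queriesLE_pure hlast _

variable {pick : Point d → Point d → Finset (Fin d)}

/-- Either half has length at most `⌈D/2⌉`, which matches the recursion of the ceiling logarithm. -/
lemma queriesLE_binarySearch (hpick : IsHalving pick) :
    ∀ (fuel : ℕ) (left right : Point d), differ q₀ z ⊆ differ left z →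
      differ left z ⊆ differ right z → 0 < hammingDist left right →
      QueriesLE (binarySearch pick Q z fuel left right) (Nat.clog 2 (hammingDist left right))
        (∀ S ∈ ·, ∃ j ∈ agree q₀ z, S = {j}) := by
  intro fuel
  induction fuel with
  | zero => intro left right _ _ _; exact queriesLE_pure (by simp) _
  | succ fuel ih =>
    intro left right hsub hlr hD
    rw [binarySearch]
    split_ifs with h1
    · obtain ⟨hlm, hmr, hc1, hc2⟩ := hpick.midpoint hlr
      have hclog : Nat.clog 2 (hammingDist left right) =
          Nat.clog 2 ((hammingDist left right + 1) / 2) + 1 := Nat.clog_of_two_le one_lt_two h1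
      rw [hclog]
      refine ((queriesLE_ask Q _).bind
        (b' := Nat.clog 2 ((hammingDist left right + 1) / 2)) ?_).mono (by omega) fun _ h => h
      intro a _
      split_ifs
      · exact (ih _ _ (hsub.trans hlm) hmr (by omega)).mono
          (Nat.clog_mono_right 2 (by omega)) fun _ h => h
      · exact (ih _ _ hsub hlm (by omega)).mono
          (Nat.clog_mono_right 2 (by omega)) fun _ h => h
    · obtain ⟨j, hja, hj, -⟩ := exists_differ_eq_singleton hlr (by omega)
      refine queriesLE_pure ?_ _
      rintro S hS
      obtain rfl : differ left right = S := by simpa using hS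
      exact ⟨j, agree_antitone hsub hja, hj⟩

lemma queriesLE_fastInner (hpick : IsHalving pick) (hq : hammingDist q₀ z < ⌊R⌋₊) :
    QueriesLE (fastInner pick Q z R q₀) (1 + Nat.clog 2 ⌊R⌋₊)
      (∀ S ∈ ·, ∃ j ∈ agree q₀ z, S = {j}) := by
  rw [fastInner]
  refine ((queriesLE_sample _).bind (b' := 1 + Nat.clog 2 ⌊R⌋₊) ?_).mono (by omega) fun _ h => h
  rintro (_ | S) hS
  · exact queriesLE_pure (by simp) _
  obtain ⟨hSa, hSc⟩ := mem_powersetCard.1 (hS S rfl)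
  refine (queriesLE_ask Q _).bind ?_
  intro a _
  split_ifs
  · exact queriesLE_pure (by simp) _
  have hd : hammingDist q₀ (flipBits q₀ S) = ⌊R⌋₊ - hammingDist q₀ z := by
    rw [← card_differ, differ_flipBits_self, hSc]
  refine (queriesLE_binarySearch hpick _ _ _ subset_rfl ?_ (by omega)).mono
    (Nat.clog_mono_right 2 (by omega)) fun _ h => h
  rw [differ_flipBits hSa]
  exact subset_union_left

variable {inner : Point d → QueryM (Option (Finset (Fin d)))} {b : ℕ}

lemma queriesLE_outerLoop (hinner : ∀ q, (hammingDist q z : ℝ) < r →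
      QueriesLE (inner q) b (∀ S ∈ ·, ∃ j ∈ agree q z, S = {j})) :
    ∀ (fuel : ℕ) (q : Point d), QueriesLE (outerLoop Q z r inner fuel q)
      ((b + 1) * (⌈r⌉₊ - hammingDist q z) + 1) fun _ => True := by
  intro fuel
  induction fuel with
  | zero => intro q; exact queriesLE_pure trivial _
  | succ fuel ih =>
    intro q
    rw [outerLoop]
    refine ((queriesLE_ask Q q).bind (b' := (b + 1) * (⌈r⌉₊ - hammingDist q z)) ?_).mono
      (by omega) fun _ h => h
    intro a _
    split_ifs with hQ hr
    · exact queriesLE_pure trivial _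
    · rw [not_le] at hr
      have hlt : hammingDist q z < ⌈r⌉₊ := Nat.lt_ceil.2 hr
      obtain ⟨x, hx⟩ : ∃ x, ⌈r⌉₊ - hammingDist q z = x + 1 :=
        ⟨⌈r⌉₊ - hammingDist q z - 1, by omega⟩
      refine ((hinner q hr).bind (b' := (b + 1) * x + 1) (post := fun _ => True) ?_).mono
        (by rw [hx]; linarith) fun _ h => h
      rintro (_ | S) hS
      · exact queriesLE_pure trivial _
      obtain ⟨j, hj, rfl⟩ := hS S rfl
      have := ih (flipBits q {j})
      rwa [hammingDist_flipBits_singleton hj,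
        show ⌈r⌉₊ - (hammingDist q z + 1) = x by omega] at this
    · exact queriesLE_pure trivial _

lemma queriesLE_walk (hinner : ∀ q, (hammingDist q z : ℝ) < r →
      QueriesLE (inner q) b (∀ S ∈ ·, ∃ j ∈ agree q z, S = {j})) :
    QueriesLE (walk Q z r lam inner) ((b + 1) * (⌈r⌉₊ - ⌊r - offset lam⌋₊) + 1)
      fun _ => True := by
  rw [walk]
  refine ((queriesLE_sample _).bind
    (b' := (b + 1) * (⌈r⌉₊ - ⌊r - offset lam⌋₊) + 1) ?_).mono (by omega) fun _ h => h
  rintro (_ | q) hq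
  · exact queriesLE_pure trivial _
  have hq' := hq q rfl
  simp only [sphere, mem_filter, mem_univ, true_and] at hq'
  simpa only [hq'] using queriesLE_outerLoop hinner (d + 1) q

lemma queries_le_of_mem_support_attack [NeZero d] {k L : ℕ} {tie : TieBreak d k L}
    {P : Finset (Point d)} {adversary : (Point d → Option (Point d)) → QueryM (Option (Point d))}
    (h : ∀ Q, QueriesLE (adversary Q) b fun _ => True)
    {w : HashFamily d k L × Option (Point d) × ℕ}
    (hw : w ∈ (attack tie P R adversary).support) : w.2.2 ≤ b := by
  rw [attack, PMF.mem_support_bind_iff] at hw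
  obtain ⟨G, -, hw⟩ := hw
  rw [PMF.mem_support_map_iff] at hw
  obtain ⟨p, hp, rfl⟩ := hw
  simpa using (h _ 0 p hp).1

end Queries

/-! ### Final query bounds and success probability -/

namespace Admissible

variable {n d : ℕ} {r c lam : ℝ}

lemma passes_le (h : Admissible n d r c lam) :
    ((⌈r⌉₊ - ⌊r - offset lam⌋₊ : ℕ) : ℝ) ≤ 33 * max lam 1 := by
  have h1 : ⌊r - offset lam⌋₊ ≤ ⌈r⌉₊ :=
    (Nat.floor_le_floor (by linarith [h.offset_pos])).trans (Nat.floor_le_ceil r)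
  rw [Nat.cast_sub h1]
  linarith [Nat.ceil_lt_add_one h.r_pos.le, h.start_bounds.1, h.offset_le, le_max_left lam 1,
    le_max_right lam 1]

lemma two_le_cr (h : Admissible n d r c lam) : 2 ≤ c * r := by
  linarith [h.r_lt, h.r_large, h.log_bounds.1]

lemma r_add_one_le (h : Admissible n d r c lam) : r + 1 ≤ c * r := by
  have h1 := h.log_mul_c_sub_one
  have h2 := h.log_lam_nonneg
  have h3 : Real.log n ≤ r := by linarith [h.r_large, h.log_bounds.1]
  have h4 := mul_le_mul_of_nonneg_right h3 (by linarith [h.one_lt_c] : 0 ≤ c - 1)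
  linarith

lemma simple_queries_le (h : Admissible n d r c lam) :
    (((⌊c * r⌋₊ + 1 + 1) * (⌈r⌉₊ - ⌊r - offset lam⌋₊) + 1 : ℕ) : ℝ) ≤
      200 * (c * r * max lam 1) := by
  have h1 := h.passes_le
  have h2 := h.two_le_cr
  have h3 := Nat.floor_le (by linarith : 0 ≤ c * r)
  have h4 := le_max_right lam 1
  have h5 : 2 * 1 ≤ c * r * max lam 1 := mul_le_mul h2 h4 zero_le_one (by linarith)
  have h6 : ((⌊c * r⌋₊ : ℝ) + 1 + 1) * ((⌈r⌉₊ - ⌊r - offset lam⌋₊ : ℕ) : ℝ) ≤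
      (2 * (c * r)) * (33 * max lam 1) :=
    mul_le_mul (by linarith) h1 (Nat.cast_nonneg _) (by linarith)
  push_cast
  linarith

lemma fast_queries_le (h : Admissible n d r c lam) :
    (((1 + Nat.clog 2 ⌊c * r⌋₊ + 1) * (⌈r⌉₊ - ⌊r - offset lam⌋₊) + 1 : ℕ) : ℝ) ≤
      200 * (Real.logb 2 (c * r) * max lam 1) := by
  have h1 := h.passes_le
  have h2 := h.two_le_cr
  have h3 := Nat.floor_le (by linarith : 0 ≤ c * r)
  have h4 := le_max_right lam 1
  have hlog : 1 ≤ Real.logb 2 (c * r) := by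
    rw [Real.le_logb_iff_rpow_le (by norm_num) (by linarith)]
    simpa using h2
  have hfl : (1 : ℝ) ≤ ⌊c * r⌋₊ := by
    exact_mod_cast (Nat.one_le_floor_iff _).2 (by linarith)
  have hclog : (Nat.clog 2 ⌊c * r⌋₊ : ℝ) ≤ Real.logb 2 (c * r) + 1 := by
    have h7 : Real.logb 2 ⌊c * r⌋₊ ≤ Real.logb 2 (c * r) :=
      Real.logb_le_logb_of_le (by norm_num) (by linarith) h3
    have h8 := Nat.ceil_lt_add_one (Real.logb_nonneg (b := 2) (by norm_num) hfl)
    have h9 := Real.natCeil_logb_natCast 2 ⌊c * r⌋₊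
    push_cast at h9
    rw [h9] at h8
    linarith
  have h5 : 1 * 1 ≤ Real.logb 2 (c * r) * max lam 1 :=
    mul_le_mul hlog h4 zero_le_one (by linarith)
  have h6 : (1 + (Nat.clog 2 ⌊c * r⌋₊ : ℝ) + 1) * ((⌈r⌉₊ - ⌊r - offset lam⌋₊ : ℕ) : ℝ) ≤
      (4 * Real.logb 2 (c * r)) * (33 * max lam 1) :=
    mul_le_mul (by linarith) h1 (Nat.cast_nonneg _) (by linarith)
  push_cast
  linarith

variable [NeZero d] {P : Finset (Point d)} {z : Point d}
  {tie : TieBreak d (hashLen n d r c) (numHashes n d r c lam)}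

open scoped Classical in
/-- With probability at least `1/2`, few hash functions collide at the starting point, and all of
those read many coordinates. -/
lemma card_bad_le (h : Admissible n d r c lam) {q : Point d}
    (hq : hammingDist q z = ⌊r - offset lam⌋₊) :
    ((univ.filter fun G : HashFamily d (hashLen n d r c) (numHashes n d r c lam) =>
      r < ((⌊r - offset lam⌋₊ + (survivors G z q).card : ℕ) : ℝ) ∨
      ∃ l ∈ survivors G z q, 4 * (coords (G l)).card < 3 * hashLen n d r c).card : ℝ) ≤
      1 / 2 * Fintype.card (HashFamily d (hashLen n d r c) (numHashes n d r c lam)) := by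
  have h1 := card_filter_many_survivors_mul_le (k := hashLen n d r c)
    (L := numHashes n d r c lam) z q (offset lam)
  have h2 := card_filter_few_coords_le (L := numHashes n d r c lam) h.hashLen_pos z q
  rw [card_agree, hq] at h1 h2
  have hM := h.numHashes_mul_start_le
  set M : ℝ := numHashes n d r c lam *
    (((d - ⌊r - offset lam⌋₊ : ℕ) : ℝ) / d) ^ hashLen n d r c with hMdef
  set H : ℝ := (Fintype.card (HashFamily d (hashLen n d r c) (numHashes n d r c lam)) : ℝ)
  have hH : 0 ≤ H := Nat.cast_nonneg _
  have ht := h.offset_pos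
  have hmany : ((univ.filter fun G : HashFamily d (hashLen n d r c) (numHashes n d r c lam) =>
      offset lam ≤ (survivors G z q).card).card : ℝ) ≤ 1 / 4 * H := by
    -- The mean `e (λ + 1)` equals `t/(2e)`, and `2e ≥ 4`.
    have h3 : Real.exp 1 * (lam + 1) ≤ 1 / 4 * offset lam := by
      have h4 : 2 ≤ Real.exp 1 := by linarith [Real.exp_one_gt_d9]
      have h5 : 0 ≤ Real.exp 1 * (lam + 1) := by
        have := h.lam_nonneg
        positivity
      unfold offset
      nlinarith
    refine le_of_mul_le_mul_right (h1.trans ?_) ht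
    have := mul_le_mul_of_nonneg_right (hM.trans h3) hH
    linarith
  have hfew : ((univ.filter fun G : HashFamily d (hashLen n d r c) (numHashes n d r c lam) =>
      ∃ l ∈ survivors G z q, 4 * (coords (G l)).card < 3 * hashLen n d r c).card : ℝ) ≤
      1 / 4 * H := by
    have ha : (0 : ℝ) < ((d - ⌊r - offset lam⌋₊ : ℕ) : ℝ) := by
      rw [Nat.cast_sub h.start_le_dim]
      linarith [h.start_bounds.2, h.offset_pos, h.r_le_dim, h.r_pos]
    refine le_of_mul_le_mul_right (h2.trans ?_) ha
    have h3 : 4 * (hashLen n d r c : ℝ) * M ≤ 1 / 4 * ((d - ⌊r - offset lam⌋₊ : ℕ) : ℝ) :=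
      (mul_le_mul_of_nonneg_left hM (by positivity)).trans h.few_coords_bound
    have := mul_le_mul_of_nonneg_right h3 hH
    linarith
  rw [filter_or]
  refine (Nat.cast_le.2 (card_union_le _ _)).trans ?_
  rw [Nat.cast_add]
  have hsub : ((univ.filter fun G : HashFamily d (hashLen n d r c) (numHashes n d r c lam) =>
      r < ((⌊r - offset lam⌋₊ + (survivors G z q).card : ℕ) : ℝ)).card : ℝ) ≤
      ((univ.filter fun G : HashFamily d (hashLen n d r c) (numHashes n d r c lam) =>
      offset lam ≤ (survivors G z q).card).card : ℝ) := by
    refine Nat.cast_le.2 (card_le_card (monotone_filter_right _ fun G _ hG => ?_))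
    rw [Nat.cast_add] at hG
    linarith [h.start_bounds.2]
  linarith

/-- Both walks succeed with probability at least `1/4`, provided that their inner procedure finds
an informative bit except with a small probability. -/
lemma attack_walk_success (h : Admissible n d r c lam)
    (hP : ∀ p ∈ P, p ≠ z → 2 * (c * r) ≤ (hammingDist p z : ℝ))
    {inner : (Point d → Option (Point d)) → Point d → QueryM (Option (Finset (Fin d)))}
    (hinner : ∀ G q, ∀ β : ℝ≥0, β ≤ 1 →
      (∀ l ∈ survivors G z q, ((d - (coords (G l)).card : ℕ) : ℝ) ≤ β * d) →
      (hammingDist q z : ℝ) ≤ c * r → (survivors G z q).Nonempty → ∀ m,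
      failProb (inner (queryLSH tie P (c * r) G) q)
        (fun o => ∃ j, o = some {j} ∧ Informative G z q j) m ≤
        (survivors G z q).card * (β : ℝ≥0∞) ^ (⌊c * r⌋₊ - hammingDist q z)) :
    ENNReal.ofReal (1 / 4 - 1 / n) ≤
      (attack tie P (c * r) fun Q => walk Q z r lam (inner Q)).toOuterMeasure
        (successEvent tie P (c * r) r z) := by
  classical
  refine le_toOuterMeasure_of_compl_le ?_ (sub_le_self _ (by positivity))
  have h34 : (((1 / 2 : ℝ≥0) : ℝ≥0∞) + ((1 / 4 : ℝ≥0) : ℝ≥0∞)) = 3 / 4 := by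
    rw [← ENNReal.coe_add, show (1 / 2 + 1 / 4 : ℝ≥0) = 3 / 4 by norm_num,
      ENNReal.coe_div (by norm_num)]
    simp
  rw [← h34]
  refine attack_walk_compl_successEvent_le h.start_le_dim (fun q G =>
    r < ((⌊r - offset lam⌋₊ + (survivors G z q).card : ℕ) : ℝ) ∨
      ∃ l ∈ survivors G z q, 4 * (coords (G l)).card < 3 * hashLen n d r c) ?_ ?_
  · intro q hq
    simp only [sphere, mem_filter, mem_univ, true_and] at hq
    have := h.card_bad_le (n := n) (z := z) hq
    have h' : ((univ.filter fun G : HashFamily d (hashLen n d r c) (numHashes n d r c lam) =>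
      r < ((⌊r - offset lam⌋₊ + (survivors G z q).card : ℕ) : ℝ) ∨
      ∃ l ∈ survivors G z q, 4 * (coords (G l)).card < 3 * hashLen n d r c).card : ℝ≥0) ≤
      1 / 2 * (Fintype.card (HashFamily d (hashLen n d r c) (numHashes n d r c lam)) : ℝ≥0) := by
      rw [← NNReal.coe_le_coe]
      simpa using this
    have h'' := ENNReal.coe_le_coe.2 h'
    rw [ENNReal.coe_mul, ENNReal.coe_natCast, ENNReal.coe_natCast] at h''
    exact h''
  · intro G q hq hbad m
    simp only [sphere, mem_filter, mem_univ, true_and] at hq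
    push Not at hbad
    obtain ⟨hN, hcoords⟩ := hbad
    have hr := h.r_pos.le
    set β := missRate d (hashLen n d r c)
    have hβ : ∀ l ∈ survivors G z q, ((d - (coords (G l)).card : ℕ) : ℝ) ≤ β * d := fun l hl =>
      sub_le_missRate_mul (NeZero.pos d) (by simpa using card_le_univ (coords (G l)))
        (hcoords l hl)
    -- All later points have at most the survivors of the start and lie at distance at most `r`, so
    -- one `ε`, with `⌊cr⌋ - ⌊r⌋` flips, serves every pass.
    refine (failProb_outerLoop (q₀ := q)
      (ε := (survivors G z q).card * (β : ℝ≥0∞) ^ (⌊c * r⌋₊ - ⌊r⌋₊)) hP h.r_lt ?_ d q subset_rfl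
      ?_ (by rwa [hq]) m).trans ?_
    · intro q' hsub hq' hne m'
      have hs := survivors_antitone (G := G) hsub
      refine (hinner G q' β (missRate_le_one _ _) (fun l hl => hβ l (hs hl))
        (hq'.trans h.r_lt.le) hne m').trans ?_
      refine mul_le_mul' (by exact_mod_cast card_le_card hs) ?_
      refine pow_le_pow_right_of_le_one' (by exact_mod_cast missRate_le_one _ _) ?_
      exact Nat.sub_le_sub_left (Nat.le_floor hq') _
    · have : ((survivors G z q).card : ℝ) ≤ d := by
        push_cast at hN
        have h0 : (0 : ℝ) ≤ ⌊r - offset lam⌋₊ := Nat.cast_nonneg _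
        linarith [h.r_le_dim]
      exact_mod_cast this
    · have h1 := h.missRate_bound hN
      have h2 : ((survivors G z q).card : ℝ≥0) *
          ((survivors G z q).card * β ^ (⌊c * r⌋₊ - ⌊r⌋₊)) ≤ 1 / 4 := by
        rw [← NNReal.coe_le_coe]
        simpa using h1
      have h3 := ENNReal.coe_le_coe.2 h2
      rw [ENNReal.coe_mul, ENNReal.coe_mul, ENNReal.coe_pow, ENNReal.coe_natCast] at h3
      exact h3

end Admissible

end AdversarialLSH

end

theorem mainTheorem1 :
    ∃ C : ℝ, 0 < C ∧
      ∀ (n d : ℕ) [NeZero d] (r c lam : ℝ) (P : Finset (Point d)) (z : Point d)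
        (tie : TieBreak d (hashLen n d r c) (numHashes n d r c lam))
        (pick : Point d → Point d → Finset (Fin d)),
        P.card = n →
        Real.exp 1 < n →
        28 * Real.log n ^ 3 ≤ r →
        r ≤ d / (28 * Real.log n) →
        0 ≤ lam →
        lam ≤ 1 / (8 * Real.exp 1 ^ 2) * min (r / Real.log n) ((n : ℝ) ^ (1 / 8 : ℝ)) - 1 →
        1 + (80 + 16 * Real.log (lam + 1)) / Real.log n ≤ c →
        c ≤ Real.log n →
        z ∈ P →
        (∀ p ∈ P, p ≠ z → 2 * c * r ≤ (hammingDist p z : ℝ)) →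
        IsHalving pick →
        (ENNReal.ofReal (1 / 4 - 1 / n) ≤
            (attack tie P (c * r) (simpleWalk z r c lam)).toOuterMeasure
              (successEvent tie P (c * r) r z) ∧
          ∀ w ∈ (attack tie P (c * r) (simpleWalk z r c lam)).support,
            (w.2.2 : ℝ) ≤ C * (c * r * max lam 1)) ∧
        (ENNReal.ofReal (1 / 4 - 1 / n) ≤
            (attack tie P (c * r) (fastWalk pick z r c lam)).toOuterMeasure
              (successEvent tie P (c * r) r z) ∧
          ∀ w ∈ (attack tie P (c * r) (fastWalk pick z r c lam)).support,
            (w.2.2 : ℝ) ≤ C * (Real.logb 2 (c * r) * max lam 1)) := by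
  -- There are at most `33 max(λ, 1)` passes, of at most `2cr` or `4 log₂(cr)` queries each, plus
  -- one last query; `200` covers both.
  refine ⟨200, by norm_num, ?_⟩
  intro n d _ r c lam P z tie pick _ hn hr hrd hlam0 hlam hc hcn hz hP hpick
  have h : Admissible n d r c lam := ⟨hn, hr, hrd, hlam0, hlam, hc, hcn⟩
  simp_rw [mul_assoc (2 : ℝ)] at hP
  have hR : 0 ≤ c * r := by linarith [h.two_le_cr]
  have hRd : c * r ≤ d := by linarith [h.cr_le]
  refine ⟨⟨?_, fun w hw => ?_⟩, ⟨?_, fun w hw => ?_⟩⟩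
  · refine h.attack_walk_success hP fun G q β _ hβ _ hs m => ?_
    rw [← add_zero ((_ : ENNReal) * _)]
    refine (failProb_bind_le (ok := fun o => ∃ j, o = some j ∧ Informative G z q j) ?_).trans
      (add_le_add_left (failProb_simpleInner hz hP hR hRd hβ (d + 1) none q subset_rfl
        (by omega) (fun h => absurd hs (by simp [h])) m) 0)
    rintro _ ⟨j, rfl, hj⟩ m
    exact (failProb_pure ⟨j, rfl, hj⟩ m).le
  · refine (Nat.cast_le.2 (queries_le_of_mem_support_attack (fun Q => ?_) hw)).trans
      h.simple_queries_le
    refine queriesLE_walk fun q hq => ?_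
    refine ((queriesLE_simpleInner (q₀ := q) (d + 1) none q subset_rfl (hq.le.trans h.r_lt.le)
      (by simp)).bind (b' := 0) ?_).mono (by omega) fun _ h => h
    intro o ho
    refine queriesLE_pure ?_ _
    rintro S hS
    obtain ⟨j, hj, rfl⟩ := Option.map_eq_some_iff.1 (Option.mem_def.1 hS)
    exact ⟨j, ho j hj, rfl⟩
  · exact h.attack_walk_success hP fun G q β hβ1 hβ hq hs m =>
      failProb_fastInner hz hP hR hRd hpick hβ1 hβ hq hs m
  · refine (Nat.cast_le.2 (queries_le_of_mem_support_attack (fun Q => ?_) hw)).trans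
      h.fast_queries_le
    refine queriesLE_walk fun q hq => queriesLE_fastInner hpick ?_
    -- The binary search needs at least one bit to flip; `cr ≥ r + 1` leaves room for it.
    have h1 : ((hammingDist q z + 1 : ℕ) : ℝ) ≤ c * r := by
      push_cast
      linarith [h.r_add_one_le]
    exact Nat.lt_of_succ_le (Nat.le_floor h1)
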